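/- Let $G$ be a finite group. A generalised character of a finite group is a $\mathbb{Z}$-linear combination of its irreducible complex characters; its degree is its value at the identity, and its determinant is defined by $\det(\tau_1-\tau_2)=\det\tau_1\otimes\overline{\det\tau_2}$ for characters $\tau_1,\tau_2$ of representations. A permutation character of $G$ is a $\mathbb{Z}$-linear combination of characters of permutation representations $\mathbb{C}[X]$ of $G$, where $X$ is a finite $G$-set. Write $D_{2n}$ for the dihedral group of order $2n$ and $C_n$ for the cyclic group of order $n$. Let $\mathcal{P}$ be a set of real-valued generalised characters of $G$ such that 1. $\mathrm{Ind}_H^G\tau\in\mathcal{P}$ for every subgroup $H\le G$ and every real-valued generalised character $\tau$ of $H$ of degree $0$ and trivial determinant that factors through a quotient of $H$ that is either cyclic or isomorphic to $C_2\times C_2$, to $D_8$, or to $D_{2p}$ for some odd prime $p$; 2. if $\tau_1,\dots,\tau_k\in\mathcal{P}$ and $n_1,\dots,n_k\in\mathbb{Z}$, then $\sum_i n_i\tau_i\in\mathcal{P}$. Then $\mathcal{P}$ contains all permutation characters of $G$ that have degree $0$ and trivial determinant. -/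

import Mathlib

open scoped ComplexConjugate

noncomputable section

namespace CharInduction

variable {G : Type*} [Group G]

/-- `χ` is an irreducible complex character of `G`. Every finite-dimensional complex
representation is isomorphic to one on some `ℂⁿ`, so it suffices to use these spaces. -/
def IsIrreducibleCharacter (χ : G → ℂ) : Prop :=
  ∃ (n : ℕ) (ρ : Representation ℂ G (Fin n → ℂ)), ρ.IsIrreducible ∧ χ = ρ.character

/-- Generalised characters: the `ℤ`-linear combinations of irreducible complex characters. -/
def IsGeneralisedCharacter (χ : G → ℂ) : Prop :=
  χ ∈ AddSubgroup.closure {ψ : G → ℂ | IsIrreducibleCharacter ψ}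

/-- Real-valued functions on `G`. -/
def IsRealValued (χ : G → ℂ) : Prop :=
  ∀ g : G, conj (χ g) = χ g

/-- The degree of a generalised character, i.e. its value at the identity. -/
def degree (χ : G → ℂ) : ℂ :=
  χ 1

/-- `δ` is the determinant of the generalised character `χ`: writing `χ = χ₁ - χ₂` with `χ₁, χ₂`
the characters of representations `ρ₁, ρ₂`, it is `det ρ₁ ⊗ (complex conjugate of det ρ₂)`.
For finite `G` every generalised character has exactly one determinant: `χ` determines the
`ρᵢ` up to adding a common representation to both, which does not change `δ`. -/
def IsDeterminantOf (δ χ : G → ℂ) : Prop :=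
  ∃ (m n : ℕ) (ρ₁ : Representation ℂ G (Fin m → ℂ)) (ρ₂ : Representation ℂ G (Fin n → ℂ)),
    χ = ρ₁.character - ρ₂.character ∧
      ∀ g : G, δ g = LinearMap.det (ρ₁ g) * conj (LinearMap.det (ρ₂ g))

/-- The determinant of `χ` is the trivial character. -/
def HasTrivialDeterminant (χ : G → ℂ) : Prop :=
  IsDeterminantOf (fun _ => 1) χ

/-- `χ` is the character of a permutation representation `ℂ[X]`, with `X` a finite `G`-set
(up to isomorphism, `X = {0, …, n - 1}`). -/
def IsPermutationRepresentationCharacter (χ : G → ℂ) : Prop :=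
  ∃ (n : ℕ) (_ : MulAction G (Fin n)),
    χ = (Representation.ofMulAction ℂ G (Fin n)).character

/-- Permutation characters: the `ℤ`-linear combinations of characters of permutation
representations. -/
def IsPermutationCharacter (χ : G → ℂ) : Prop :=
  χ ∈ AddSubgroup.closure {ψ : G → ℂ | IsPermutationRepresentationCharacter ψ}

open scoped Classical in
/-- Induction from `H` to `G`:
`(Ind_H^G τ)(g) = |H|⁻¹ ∑_{x ∈ G, x⁻¹ g x ∈ H} τ (x⁻¹ g x)`. -/
def induced [Fintype G] (H : Subgroup G) (τ : H → ℂ) : G → ℂ := fun g =>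
  (Nat.card H : ℂ)⁻¹ *
    ∑ x : G, if h : x⁻¹ * g * x ∈ H then τ ⟨x⁻¹ * g * x, h⟩ else 0

/-- `Q` is cyclic, or isomorphic to `C₂ × C₂`, to the dihedral group `D₈` of order `8`, or to the
dihedral group `D_{2p}` of order `2p` for an odd prime `p`.
(Mathlib's `DihedralGroup n` has order `2n`.) -/
def IsBasicGroup (Q : Type*) [Group Q] : Prop :=
  IsCyclic Q ∨
  Nonempty (Q ≃* Multiplicative (ZMod 2) × Multiplicative (ZMod 2)) ∨
  Nonempty (Q ≃* DihedralGroup 4) ∨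
  ∃ p : ℕ, p.Prime ∧ Odd p ∧ Nonempty (Q ≃* DihedralGroup p)

/-- `τ` is the inflation of a generalised character of a quotient of `G` which is cyclic or
isomorphic to `C₂ × C₂`, `D₈` or `D_{2p}` for an odd prime `p`. -/
def FactorsThroughBasicQuotient (τ : G → ℂ) : Prop :=
  ∃ (N : Subgroup G) (_ : N.Normal), IsBasicGroup (G ⧸ N) ∧
    ∃ σ : G ⧸ N → ℂ, IsGeneralisedCharacter σ ∧ ∀ g : G, τ g = σ (QuotientGroup.mk g)

end CharInduction

end

noncomputable section

namespace CharInduction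

universe u

/-! ### Traces of powers determine determinants -/

/-! The determinant of a permutation representation is the sign of the action, and traces of powers
determine determinants. So a permutation character of degree 0 and trivial determinant is a
difference of the characters of two finite `G`-sets of equal size and equal sign (`IsPermZero`). The
task is to place every such difference in `basicSpan G`, which lies in `P` by `basicSpan_subset`.

It suffices to do this for each prime `p` up to an integer factor prime to `p`
(`mem_basicSpan_of_forall_localSpan`). For each `x` there is a `G`-set induced from a
`p`-hyperelementary subgroup on which the number of fixed points of `x` is prime to `p`
(`exists_isHyper_subgroup`). Multiplying by its permutation character `b` is restriction followed by
induction, and multiplying by `b - b x` kills the value at `x`; induction on the size of the support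
(`isGoodGroup`) therefore reduces everything to hyperelementary groups.

There (`IsHyper.isGoodGroup`) the argument is by induction on the order. An action is compared with
a trivial action plus its sign character; this correction is additive up to `1 + st - s - t` for
signs `s`, `t`, which comes from a quotient embedding in `C₂ × C₂`. Only faithful transitive actions
`G/H` remain. If `H` lies in a proper subgroup `M` containing a nontrivial normal subgroup of `G`,
the action is induced from `M`, and for odd `p` nothing else is needed. For `p = 2` actions induced
from sign actions of `M` must also be treated: either they are not faithful, or `G` is a 2-group
inside `S₄`, which is where `D₈` enters.

The remaining case is `G = L ⋊ H` with `L` normal of prime order `ℓ` and `H` a `p`-group acting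
faithfully on `L`. There `ℂ[G/H] - 1 - r ℂ[G/L]`, with `r` the index of the image of `G` in
`(ℤ/ℓ)ˣ`, equals `-ℓ` on `L \ {1}` and `0` elsewhere. Twice this function is induced from `L`; if
`H` contains an involution, the function itself is induced from a dihedral subgroup of order `2ℓ`.
-/

theorem exists_eigenvalue_multiset {V : Type*} [AddCommGroup V] [Module ℂ V]
    [FiniteDimensional ℂ V] (f : Module.End ℂ V) {n : ℕ} (hn : 0 < n) (hf : f ^ n = 1) :
    ∃ s : Multiset ℂ, (∀ k : ℕ, LinearMap.trace ℂ V (f ^ k) = (s.map (· ^ k)).sum) ∧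
      LinearMap.det f = s.prod := by
  classical
  have hss : f.IsSemisimple := by
    refine Module.End.isSemisimple_of_squarefree_aeval_eq_zero
      (p := Polynomial.X ^ n - Polynomial.C 1) ?_ (by simp [hf])
    exact (Polynomial.separable_X_pow_sub_C (1 : ℂ) (by exact_mod_cast hn.ne') one_ne_zero).squarefree
  have htop := hss.iSup_eigenspace_eq_top
  have hint : DirectSum.IsInternal fun μ : ℂ => f.eigenspace μ := by
    rw [DirectSum.isInternal_submodule_iff_iSupIndep_and_iSup_eq_top]
    exact ⟨f.eigenspaces_iSupIndep, htop⟩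
  let b := hint.collectedBasis fun μ => Module.finBasis ℂ (f.eigenspace μ)
  have : Fintype (Σ μ : ℂ, Fin (Module.finrank ℂ (f.eigenspace μ))) :=
    FiniteDimensional.fintypeBasisIndex b
  have hb : ∀ i, f (b i) = i.1 • b i := fun i =>
    Module.End.mem_eigenspace_iff.1 (hint.collectedBasis_mem _ i)
  have hbk : ∀ (k : ℕ) i, (f ^ k) (b i) = i.1 ^ k • b i := by
    intro k i
    induction k with
    | zero => simp
    | succ k ih => rw [pow_succ', Module.End.mul_apply, ih, map_smul, hb, smul_smul, pow_succ]
  have hmat : ∀ k : ℕ, LinearMap.toMatrix b b (f ^ k) = Matrix.diagonal fun i => i.1 ^ k := by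
    intro k
    ext i j
    rw [LinearMap.toMatrix_apply, hbk, map_smul, Module.Basis.repr_self, Finsupp.smul_single,
      Matrix.diagonal_apply, Finsupp.single_apply]
    by_cases h : i = j
    · simp [h]
    · simp [h, Ne.symm h]
  refine ⟨Finset.univ.val.map fun i : (Σ μ : ℂ, Fin (Module.finrank ℂ (f.eigenspace μ))) => i.1,
    fun k => ?_, ?_⟩
  · rw [LinearMap.trace_eq_matrix_trace ℂ b, hmat, Matrix.trace_diagonal, Multiset.map_map]
    rfl
  · have h1 := hmat 1
    rw [pow_one] at h1
    rw [← LinearMap.det_toMatrix b, h1, Matrix.det_diagonal]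
    simp

/-- Power sums determine the sum of any polynomial over the multiset; a polynomial that is 1 at `z`
and 0 at the other elements reads off the multiplicity of `z`. -/
theorem multiset_eq_of_powerSums_eq {s t : Multiset ℂ}
    (h : ∀ k : ℕ, (s.map (· ^ k)).sum = (t.map (· ^ k)).sum) : s = t := by
  classical
  have hpoly : ∀ p : Polynomial ℂ,
      (s.map fun z => p.eval z).sum = (t.map fun z => p.eval z).sum := by
    intro p
    induction p using Polynomial.induction_on' with
    | add p q hp hq => simp only [Polynomial.eval_add, Multiset.sum_map_add, hp, hq]
    | monomial n a => simp only [Polynomial.eval_monomial, Multiset.sum_map_mul_left, h]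
  ext z
  let S : Finset ℂ := s.toFinset ∪ t.toFinset ∪ {z}
  let p := Lagrange.interpolate S id fun w => if w = z then 1 else 0
  have hp : ∀ w ∈ S, p.eval w = if w = z then 1 else 0 := fun w hw =>
    Lagrange.eval_interpolate_at_node _ (fun _ _ _ _ h => h) hw
  have key : ∀ u : Multiset ℂ, u.toFinset ⊆ S → (u.map fun w => p.eval w).sum = u.count z := by
    intro u hu
    rw [Multiset.map_congr rfl fun w hw => hp w (hu (Multiset.mem_toFinset.2 hw))]
    rw [Finset.sum_multiset_map_count]
    simp only [nsmul_eq_mul, mul_ite, mul_one, mul_zero]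
    rw [Finset.sum_ite_eq' u.toFinset z]
    split_ifs with hz
    · rfl
    · rw [Multiset.count_eq_zero_of_notMem (fun h' => hz (Multiset.mem_toFinset.2 h'))]; simp
  have := hpoly p
  rw [key s (by intro w hw; simp [S] at hw ⊢; tauto),
    key t (by intro w hw; simp [S] at hw ⊢; tauto)] at this
  exact_mod_cast this

/-! ### Permutation characters -/

variable {G : Type*} [Group G] {X Y : Type*} [Fintype X] [Fintype Y]

open scoped Classical in
/-- The permutation representation attached to an action `a : G →* Equiv.Perm X`. -/
def permRep (a : G →* Equiv.Perm X) : Representation ℂ G (X → ℂ) where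
  -- A permutation matrix acts on functions by precomposition, which is contravariant; the inverse
  -- corrects this.
  toFun g := Matrix.toLin' (((a g)⁻¹).permMatrix ℂ)
  map_one' := by ext; simp
  map_mul' g h := by
    ext i j
    simp [Matrix.permMatrix_mulVec, Function.comp_def, Pi.single_apply]

/-- The number of fixed points, as a complex valued function. -/
def permChar {X : Type*} (a : G →* Equiv.Perm X) : G → ℂ := fun g =>
  (Nat.card {x // a g x = x} : ℂ)

/-- The sign character of an action on a finite set. -/
def sgn {X : Type*} [Finite X] (a : G →* Equiv.Perm X) : G →* ℤˣ :=
  letI := Fintype.ofFinite X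
  letI := Classical.decEq X
  Equiv.Perm.sign.comp a

theorem sgn_apply [DecidableEq X] (a : G →* Equiv.Perm X) (g : G) :
    sgn a g = Equiv.Perm.sign (a g) := by
  simp only [sgn, MonoidHom.comp_apply]
  congr!

theorem permRep_character (a : G →* Equiv.Perm X) : (permRep a).character = permChar a := by
  classical
  ext g
  change LinearMap.trace ℂ (X → ℂ) (Matrix.toLin' _) = _
  rw [Matrix.trace_toLin'_eq, Matrix.trace_permutation, permChar]
  congr 1
  refine Nat.card_congr (Equiv.subtypeEquivRight fun x => ?_)
  change (a g)⁻¹ x = x ↔ _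
  rw [Equiv.Perm.inv_eq_iff_eq]
  exact eq_comm

theorem permRep_det (a : G →* Equiv.Perm X) (g : G) :
    LinearMap.det (permRep a g) = ((sgn a g : ℤ) : ℂ) := by
  classical
  have h : permRep a g = Matrix.toLin' (((a g)⁻¹).permMatrix ℂ) := rfl
  rw [h, LinearMap.det_toLin', Matrix.det_permutation, Equiv.Perm.sign_inv, sgn_apply]

theorem permChar_one {X : Type*} (a : G →* Equiv.Perm X) : permChar a 1 = Nat.card X := by
  rw [permChar]
  congr 1
  exact Nat.card_congr (Equiv.subtypeUnivEquiv fun x => by simp)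

theorem exists_eigenvalue_multiset_rep [Finite G] {V : Type*} [AddCommGroup V] [Module ℂ V]
    [FiniteDimensional ℂ V] (ρ : Representation ℂ G V) (g : G) :
    ∃ s : Multiset ℂ, (∀ k : ℕ, ρ.character (g ^ k) = (s.map (· ^ k)).sum) ∧
      LinearMap.det (ρ g) = s.prod := by
  obtain ⟨s, hs, hd⟩ := exists_eigenvalue_multiset (ρ g) (orderOf_pos g)
    (by rw [← map_pow, pow_orderOf_eq_one, map_one])
  refine ⟨s, fun k => ?_, hd⟩
  rw [← hs, Representation.character, map_pow]

/-- The traces of the powers of `g` determine its eigenvalues with multiplicity. This makes the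
determinant of a generalised character independent of how it is written as a difference. -/
theorem det_mul_det_eq_of_character_add_eq [Finite G] {V₁ V₂ W₁ W₂ : Type*}
    [AddCommGroup V₁] [Module ℂ V₁] [FiniteDimensional ℂ V₁]
    [AddCommGroup V₂] [Module ℂ V₂] [FiniteDimensional ℂ V₂]
    [AddCommGroup W₁] [Module ℂ W₁] [FiniteDimensional ℂ W₁]
    [AddCommGroup W₂] [Module ℂ W₂] [FiniteDimensional ℂ W₂]
    (ρ₁ : Representation ℂ G V₁) (ρ₂ : Representation ℂ G V₂)
    (σ₁ : Representation ℂ G W₁) (σ₂ : Representation ℂ G W₂)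
    (h : ρ₁.character + ρ₂.character = σ₁.character + σ₂.character) (g : G) :
    LinearMap.det (ρ₁ g) * LinearMap.det (ρ₂ g) =
      LinearMap.det (σ₁ g) * LinearMap.det (σ₂ g) := by
  obtain ⟨s₁, hs₁, hd₁⟩ := exists_eigenvalue_multiset_rep ρ₁ g
  obtain ⟨s₂, hs₂, hd₂⟩ := exists_eigenvalue_multiset_rep ρ₂ g
  obtain ⟨t₁, ht₁, he₁⟩ := exists_eigenvalue_multiset_rep σ₁ g
  obtain ⟨t₂, ht₂, he₂⟩ := exists_eigenvalue_multiset_rep σ₂ g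
  have : s₁ + s₂ = t₁ + t₂ := by
    refine multiset_eq_of_powerSums_eq fun k => ?_
    rw [Multiset.map_add, Multiset.map_add, Multiset.sum_add, Multiset.sum_add, ← hs₁, ← hs₂,
      ← ht₁, ← ht₂]
    exact congrFun h (g ^ k)
  rw [hd₁, hd₂, he₁, he₂, ← Multiset.prod_add, this, Multiset.prod_add]

theorem norm_det_rep [Finite G] {V : Type*} [AddCommGroup V] [Module ℂ V]
    (ρ : Representation ℂ G V) (g : G) : ‖LinearMap.det (ρ g)‖ = 1 := by
  have h : (LinearMap.det (ρ g)) ^ orderOf g = 1 := by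
    rw [← map_pow, ← map_pow, pow_orderOf_eq_one, map_one, map_one]
  exact Complex.norm_eq_one_of_pow_eq_one h (orderOf_pos g).ne'

theorem mul_conj_det_eq_one_iff [Finite G] {V W : Type*} [AddCommGroup V] [Module ℂ V]
    [AddCommGroup W] [Module ℂ W] (ρ : Representation ℂ G V) (σ : Representation ℂ G W) (g : G) :
    1 = LinearMap.det (ρ g) * conj (LinearMap.det (σ g)) ↔
      LinearMap.det (ρ g) = LinearMap.det (σ g) := by
  have h : LinearMap.det (σ g) * conj (LinearMap.det (σ g)) = 1 := by
    rw [Complex.mul_conj, Complex.normSq_eq_norm_sq, norm_det_rep]; simp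
  constructor
  · intro h1
    have h0 : conj (LinearMap.det (σ g)) ≠ 0 := fun h0 => by simp [h0] at h
    exact mul_right_cancel₀ h0 (h1.symm.trans h.symm)
  · intro h1; rw [h1, h]

/-- Only the powers of a single `g` are needed, so signs can be compared on a subgroup where the
characters agree. -/
theorem sgn_eq_of_permChar_eq {X Y : Type*} [Finite G] [Finite X] [Finite Y]
    {a : G →* Equiv.Perm X} {b : G →* Equiv.Perm Y} {g : G}
    (h : ∀ k : ℕ, permChar a (g ^ k) = permChar b (g ^ k)) :
    sgn a g = sgn b g := by
  have := Fintype.ofFinite X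
  have := Fintype.ofFinite Y
  obtain ⟨s, hs, hd⟩ := exists_eigenvalue_multiset_rep (permRep a) g
  obtain ⟨t, ht, he⟩ := exists_eigenvalue_multiset_rep (permRep b) g
  have : s = t := by
    refine multiset_eq_of_powerSums_eq fun k => ?_
    rw [← hs, ← ht, permRep_character, permRep_character, h]
  rw [permRep_det] at hd he
  rw [this, ← he] at hd
  exact_mod_cast hd

theorem sgn_eq_of_hasTrivialDeterminant {X Y : Type*} [Finite G] [Finite X] [Finite Y]
    {a : G →* Equiv.Perm X} {b : G →* Equiv.Perm Y}
    (h : HasTrivialDeterminant (permChar a - permChar b)) (g : G) :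
    sgn a g = sgn b g := by
  have := Fintype.ofFinite X
  have := Fintype.ofFinite Y
  obtain ⟨m, n, ρ₁, ρ₂, hχ, hδ⟩ := h
  have h12 := (mul_conj_det_eq_one_iff ρ₁ ρ₂ g).1 (hδ g)
  have := det_mul_det_eq_of_character_add_eq (permRep a) ρ₂ (permRep b) ρ₁ (by
    rw [permRep_character, permRep_character]
    rw [sub_eq_iff_eq_add] at hχ
    rw [hχ]; abel) g
  rw [h12, permRep_det, permRep_det] at this
  have h0 : LinearMap.det (ρ₂ g) ≠ 0 := fun h0 => by
    have := norm_det_rep ρ₂ g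
    simp [h0] at this
  exact_mod_cast mul_right_cancel₀ h0 this

/-! ### Characters of representations are generalised characters -/

section Maschke

variable {G : Type*} [Group G]

/-- Transport of a representation along a linear equivalence. -/
def conjRep {V W : Type*} [AddCommGroup V] [Module ℂ V] [AddCommGroup W] [Module ℂ W]
    (e : V ≃ₗ[ℂ] W) (ρ : Representation ℂ G V) : Representation ℂ G W where
  toFun g := e.conj (ρ g)
  map_one' := by ext; simp
  map_mul' g h := by ext; simp [LinearEquiv.conj_apply]

theorem conjRep_character {V W : Type*} [AddCommGroup V] [Module ℂ V] [AddCommGroup W]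
    [Module ℂ W] (e : V ≃ₗ[ℂ] W) (ρ : Representation ℂ G V) :
    (conjRep e ρ).character = ρ.character := by
  ext g
  exact LinearMap.trace_conj' (ρ g) e

/-- Subrepresentations are preserved by transport along a linear equivalence. -/
def subrepresentationConjIso {V W : Type*} [AddCommGroup V] [Module ℂ V] [AddCommGroup W]
    [Module ℂ W] (e : V ≃ₗ[ℂ] W) (ρ : Representation ℂ G V) :
    Subrepresentation ρ ≃o Subrepresentation (conjRep e ρ) where
  toFun U := ⟨U.toSubmodule.map (e : V →ₗ[ℂ] W), by
    rintro g _ ⟨v, hv, rfl⟩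
    exact ⟨ρ g v, U.apply_mem_toSubmodule g hv, by simp [conjRep, LinearEquiv.conj_apply]⟩⟩
  invFun U := ⟨U.toSubmodule.comap (e : V →ₗ[ℂ] W), by
    intro g v hv
    have := U.apply_mem_toSubmodule g hv
    simpa [conjRep, LinearEquiv.conj_apply] using this⟩
  left_inv U := by
    apply Subrepresentation.toSubmodule_injective
    exact Submodule.comap_map_eq_of_injective e.injective _
  right_inv U := by
    apply Subrepresentation.toSubmodule_injective
    exact Submodule.map_comap_eq_of_surjective e.surjective _
  map_rel_iff' {U U'} := by
    change U.toSubmodule.map (e : V →ₗ[ℂ] W) ≤ U'.toSubmodule.map (e : V →ₗ[ℂ] W) ↔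
      U.toSubmodule ≤ U'.toSubmodule
    exact Submodule.map_le_map_iff_of_injective e.injective _ _

theorem character_eq_add_of_isCompl {V : Type*} [AddCommGroup V] [Module ℂ V]
    [FiniteDimensional ℂ V] (ρ : Representation ℂ G V) {U W : Subrepresentation ρ}
    (h : IsCompl U.toSubmodule W.toSubmodule) :
    ρ.character = U.toRepresentation.character + W.toRepresentation.character := by
  ext g
  have := LinearMap.trace_conj' (LinearMap.prodMap (U.toRepresentation g) (W.toRepresentation g))
    (Submodule.prodEquivOfIsCompl _ _ h)
  rw [LinearMap.trace_prodMap'] at this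
  change _ = LinearMap.trace ℂ _ (U.toRepresentation g) +
    LinearMap.trace ℂ _ (W.toRepresentation g)
  rw [← this, Representation.character]
  congr 1
  refine LinearMap.ext fun v => ?_
  obtain ⟨⟨x, y⟩, rfl⟩ := (Submodule.prodEquivOfIsCompl _ _ h).surjective v
  simp [LinearEquiv.conj_apply, Subrepresentation.toRepresentation]

/-- Maschke's theorem, applied by induction on the dimension. -/
theorem isGeneralisedCharacter_character [Finite G] {V : Type} [AddCommGroup V] [Module ℂ V]
    [FiniteDimensional ℂ V] (ρ : Representation ℂ G V) : IsGeneralisedCharacter ρ.character := by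
  induction hn : Module.finrank ℂ V using Nat.strong_induction_on generalizing V with
  | _ n ih =>
    by_cases hirr : ρ.IsIrreducible
    · let e : V ≃ₗ[ℂ] (Fin n → ℂ) := LinearEquiv.ofFinrankEq _ _ (by simp [hn])
      refine AddSubgroup.subset_closure ⟨n, conjRep e ρ, ?_, (conjRep_character e ρ).symm⟩
      exact (subrepresentationConjIso e ρ).isSimpleOrder_iff.1 hirr
    · rcases subsingleton_or_nontrivial V with hV | hV
      · have : ρ.character = 0 := by
          ext g
          rw [Representation.character, Subsingleton.elim (ρ g) 0, map_zero]
          rfl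
        rw [this]
        exact zero_mem _
      · have hnt : Nontrivial (Subrepresentation ρ) := by
          refine ⟨⊥, ⊤, fun h => ?_⟩
          have h2 := congrArg Subrepresentation.toSubmodule h
          exact bot_ne_top (α := Submodule ℂ V) h2
        have : ∃ U : Subrepresentation ρ, U ≠ ⊥ ∧ U ≠ ⊤ := by
          by_contra! hc
          exact hirr { toNontrivial := hnt, eq_bot_or_eq_top := fun U => by
                        by_cases hU : U = ⊥
                        · exact Or.inl hU
                        · exact Or.inr (hc U hU) }
        obtain ⟨U, hU0, hU1⟩ := this
        have : NeZero (Nat.card G : ℂ) := ⟨by exact_mod_cast Nat.card_pos.ne'⟩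
        obtain ⟨W, hW⟩ := (inferInstance : Representation.IsSemisimpleRepresentation ρ).exists_isCompl U
        have hW' : IsCompl U.toSubmodule W.toSubmodule := by
          rw [isCompl_iff, disjoint_iff, codisjoint_iff]
          exact ⟨congrArg Subrepresentation.toSubmodule hW.inf_eq_bot,
            congrArg Subrepresentation.toSubmodule hW.sup_eq_top⟩
        have hsum := Submodule.finrank_add_eq_of_isCompl hW'
        have hU0' : U.toSubmodule ≠ ⊥ := fun h =>
          hU0 (Subrepresentation.toSubmodule_injective h)
        have hU1' : U.toSubmodule ≠ ⊤ := fun h =>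
          hU1 (Subrepresentation.toSubmodule_injective h)
        have hlt : Module.finrank ℂ U.toSubmodule < n := hn ▸ Submodule.finrank_lt hU1'
        have hpos : 0 < Module.finrank ℂ U.toSubmodule := by
          rw [Module.finrank_pos_iff]
          exact (Submodule.nontrivial_iff_ne_bot).2 hU0'
        rw [character_eq_add_of_isCompl ρ hW']
        exact add_mem (ih _ hlt U.toRepresentation rfl)
          (ih _ (by omega) W.toRepresentation rfl)

end Maschke

theorem IsBasicGroup.of_mulEquiv {Q Q' : Type*} [Group Q] [Group Q'] (e : Q ≃* Q')
    (h : IsBasicGroup Q) : IsBasicGroup Q' := by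
  rcases h with h | ⟨⟨f⟩⟩ | ⟨⟨f⟩⟩ | ⟨p, hp, ho, ⟨f⟩⟩
  · exact Or.inl (e.isCyclic.1 h)
  · exact Or.inr (Or.inl ⟨e.symm.trans f⟩)
  · exact Or.inr (Or.inr (Or.inl ⟨e.symm.trans f⟩))
  · exact Or.inr (Or.inr (Or.inr ⟨p, hp, ho, ⟨e.symm.trans f⟩⟩))

/-! ### Induction -/

section Induction

variable {G : Type*} [Group G]

open scoped Classical in
/-- Extension of a function on a subgroup by zero. -/
def extendZero (H : Subgroup G) (τ : H → ℂ) (g : G) : ℂ :=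
  if h : g ∈ H then τ ⟨g, h⟩ else 0

theorem extendZero_of_mem {H : Subgroup G} (τ : H → ℂ) {g : G} (h : g ∈ H) :
    extendZero H τ g = τ ⟨g, h⟩ := dif_pos h

theorem extendZero_of_notMem {H : Subgroup G} (τ : H → ℂ) {g : G} (h : g ∉ H) :
    extendZero H τ g = 0 := dif_neg h

variable [Finite G]

/-- Induction of functions, as a linear map. -/
def ind (H : Subgroup G) : (H → ℂ) →ₗ[ℂ] (G → ℂ) where
  toFun τ := letI := Fintype.ofFinite G; induced H τ
  map_add' τ τ' := by
    ext g
    simp only [induced, Pi.add_apply, ← mul_add, ← Finset.sum_add_distrib]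
    congr 1
    refine Finset.sum_congr rfl fun x _ => ?_
    split_ifs <;> simp
  map_smul' c τ := by
    ext g
    simp only [induced, Pi.smul_apply, smul_eq_mul, RingHom.id_apply, Finset.mul_sum]
    refine Finset.sum_congr rfl fun x _ => ?_
    split_ifs <;> simp [mul_left_comm]

theorem induced_eq_ind [Fintype G] (H : Subgroup G) (τ : H → ℂ) : induced H τ = ind H τ := by
  change _ = @induced _ _ (Fintype.ofFinite G) H τ
  congr!

theorem ind_apply [Fintype G] (H : Subgroup G) (τ : H → ℂ) (g : G) :
    ind H τ g = (Nat.card H : ℂ)⁻¹ * ∑ x : G, extendZero H τ (x⁻¹ * g * x) := by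
  rw [← induced_eq_ind]
  rfl

theorem ind_ind (M : Subgroup G) (K : Subgroup M) (τ : K → ℂ) :
    ind M (ind K τ) = ind (K.map M.subtype)
      (τ ∘ (K.equivMapOfInjective M.subtype M.subtype_injective).symm) := by
  have := Fintype.ofFinite G
  have := Fintype.ofFinite M
  set τ' := τ ∘ (K.equivMapOfInjective M.subtype M.subtype_injective).symm with hτ'
  have hmem : ∀ z : M, (z : G) ∈ K.map M.subtype ↔ z ∈ K := fun z => by
    simp [Subgroup.mem_map]
  have hext : ∀ z : M, extendZero K τ z = extendZero (K.map M.subtype) τ' z := by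
    intro z
    by_cases hz : z ∈ K
    · rw [extendZero_of_mem _ hz, extendZero_of_mem _ ((hmem z).2 hz), hτ']
      simp only [Function.comp_apply]
      congr 1
      rw [MulEquiv.eq_symm_apply]
      rfl
    · rw [extendZero_of_notMem _ hz, extendZero_of_notMem _ (mt (hmem z).1 hz)]
  have hcard : Nat.card (K.map M.subtype) = Nat.card K :=
    Nat.card_congr (K.equivMapOfInjective M.subtype M.subtype_injective).symm.toEquiv
  have houter : ∀ z : G, extendZero M (ind K τ) z =
      (Nat.card K : ℂ)⁻¹ * ∑ y : M, extendZero (K.map M.subtype) τ' ((y : G)⁻¹ * z * y) := by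
    intro z
    by_cases hz : z ∈ M
    · rw [extendZero_of_mem _ hz, ind_apply]
      congr 1
      exact Finset.sum_congr rfl fun y _ => hext _
    · rw [extendZero_of_notMem _ hz, Finset.sum_eq_zero, mul_zero]
      intro y _
      refine extendZero_of_notMem _ fun h => hz ?_
      have h' : (y : G)⁻¹ * z * y ∈ M := by
        obtain ⟨w, -, hw⟩ := h
        rw [← hw]; exact w.2
      have := M.mul_mem (M.mul_mem y.2 h') (M.inv_mem y.2)
      convert this using 1
      group
  ext g
  rw [ind_apply, ind_apply, hcard]
  simp only [houter]
  rw [← Finset.mul_sum, Finset.sum_comm]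
  -- The inner conjugation is absorbed by translating the sum over `G`, so the sum over `M`
  -- contributes only a factor `|M|`.
  have hinner : ∀ y : M, ∑ x : G, extendZero (K.map M.subtype) τ'
      ((y : G)⁻¹ * (x⁻¹ * g * x) * y) =
      ∑ x : G, extendZero (K.map M.subtype) τ' (x⁻¹ * g * x) := by
    intro y
    refine Fintype.sum_equiv (Equiv.mulRight (y : G)) _ _ fun x => ?_
    congr 1
    simp only [Equiv.coe_mulRight]
    group
  simp only [hinner, Finset.sum_const, Finset.card_univ, nsmul_eq_mul, ← Nat.card_eq_fintype_card]
  have : (Nat.card M : ℂ) ≠ 0 := by exact_mod_cast Nat.card_pos.ne'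
  field_simp

theorem sum_comp_eq_card_ker_mul_sum {G U : Type*} [Group G] [Group U] [Fintype G] [Fintype U]
    {φ : G →* U} (hφ : Function.Surjective φ) (F : U → ℂ) :
    ∑ x : G, F (φ x) = Nat.card φ.ker * ∑ y : U, F y := by
  classical
  have hfib : ∀ y : U, (Finset.univ.filter fun x => φ x = y).card = Nat.card φ.ker := by
    intro y
    obtain ⟨x₀, rfl⟩ := hφ y
    rw [← Fintype.card_subtype, ← Nat.card_eq_fintype_card]
    refine Nat.card_congr ⟨fun x => ⟨x₀⁻¹ * x.1, ?_⟩, fun k => ⟨x₀ * k.1, ?_⟩, ?_, ?_⟩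
    · simp [MonoidHom.mem_ker, x.2]
    · simp [MonoidHom.mem_ker.1 k.2]
    · intro x; simp
    · intro k; simp
  rw [← Finset.sum_fiberwise_of_maps_to (t := Finset.univ) (g := φ) (by simp), Finset.mul_sum]
  refine Finset.sum_congr rfl fun y _ => ?_
  rw [Finset.sum_congr rfl (g := fun _ => F y), Finset.sum_const, hfib, nsmul_eq_mul]
  intro x hx
  rw [(Finset.mem_filter.1 hx).2]

/-- Inflation commutes with induction: the order of the kernel enters both the sum and the order of
the preimage of `H`, and cancels. -/
theorem ind_comp {G' : Type*} [Group G'] [Finite G'] {φ : G →* G'} (hφ : Function.Surjective φ)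
    (H : Subgroup G') (τ : H → ℂ) :
    ind H τ ∘ φ = ind (H.comap φ) (τ ∘ φ.subgroupComap H) := by
  have := Fintype.ofFinite G
  have := Fintype.ofFinite G'
  have hext : ∀ z : G, extendZero (H.comap φ) (τ ∘ φ.subgroupComap H) z =
      extendZero H τ (φ z) := by
    intro z
    by_cases hz : φ z ∈ H
    · rw [extendZero_of_mem _ hz, extendZero_of_mem _ (Subgroup.mem_comap.2 hz)]
      rfl
    · rw [extendZero_of_notMem _ hz, extendZero_of_notMem _ (mt Subgroup.mem_comap.1 hz)]
  have hcard : Nat.card (H.comap φ) = Nat.card H * Nat.card φ.ker := by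
    rw [← Subgroup.card_mul_index (φ.ker.subgroupOf (H.comap φ)), mul_comm]
    congr 1
    · rw [← Subgroup.relIndex, Subgroup.relIndex_ker]
      simp [Subgroup.map_comap_eq_self_of_surjective hφ]
    · refine Nat.card_congr (Subgroup.subgroupOfEquivOfLe ?_).toEquiv
      intro z hz
      rw [Subgroup.mem_comap, MonoidHom.mem_ker.1 hz]
      exact H.one_mem
  ext g
  rw [Function.comp_apply, ind_apply, ind_apply, hcard]
  simp only [hext, map_mul, map_inv]
  rw [sum_comp_eq_card_ker_mul_sum hφ fun y => extendZero H τ (y⁻¹ * φ g * y)]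
  have h1 : (Nat.card φ.ker : ℂ) ≠ 0 := by exact_mod_cast Nat.card_pos.ne'
  have h2 : (Nat.card H : ℂ) ≠ 0 := by exact_mod_cast Nat.card_pos.ne'
  push_cast
  field_simp

/-- The projection formula. -/
theorem mul_ind {χ : G → ℂ} (hχ : ∀ x g : G, χ (x⁻¹ * g * x) = χ g) (H : Subgroup G)
    (τ : H → ℂ) : χ * ind H τ = ind H ((χ ∘ H.subtype) * τ) := by
  have := Fintype.ofFinite G
  ext g
  rw [Pi.mul_apply, ind_apply, ind_apply, mul_left_comm, Finset.mul_sum]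
  congr 1
  refine Finset.sum_congr rfl fun x _ => ?_
  by_cases h : x⁻¹ * g * x ∈ H
  · rw [extendZero_of_mem _ h, extendZero_of_mem _ h, Pi.mul_apply, Function.comp_apply,
      ← hχ x g]
    rfl
  · rw [extendZero_of_notMem _ h, extendZero_of_notMem _ h, mul_zero]

theorem ind_top {χ : G → ℂ} (hχ : ∀ x g : G, χ (x⁻¹ * g * x) = χ g) :
    ind ⊤ (χ ∘ (⊤ : Subgroup G).subtype) = χ := by
  have := Fintype.ofFinite G
  ext g
  rw [ind_apply]
  have : ∀ x : G, extendZero ⊤ (χ ∘ (⊤ : Subgroup G).subtype) (x⁻¹ * g * x) = χ g := fun x => by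
    rw [extendZero_of_mem _ (Subgroup.mem_top _)]
    exact hχ x g
  simp only [this, Finset.sum_const, Finset.card_univ, nsmul_eq_mul, ← Nat.card_eq_fintype_card,
    Subgroup.card_top]
  have : (Nat.card G : ℂ) ≠ 0 := by exact_mod_cast Nat.card_pos.ne'
  field_simp

end Induction

/-! ### The span of the induced basic characters -/

/-- `σ` is the difference of the characters of two representations with the same dimension and
the same determinant, and is real-valued. -/
def IsBalanced {Q : Type*} [Group Q] (σ : Q → ℂ) : Prop :=
  IsRealValued σ ∧ ∃ (n : ℕ) (ρ₁ ρ₂ : Representation ℂ Q (Fin n → ℂ)),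
    σ = ρ₁.character - ρ₂.character ∧ ∀ g, LinearMap.det (ρ₁ g) = LinearMap.det (ρ₂ g)

theorem IsBalanced.comp {Q Q' : Type*} [Group Q] [Group Q'] {σ : Q → ℂ} (h : IsBalanced σ)
    (φ : Q' →* Q) : IsBalanced (σ ∘ φ) := by
  obtain ⟨hr, n, ρ₁, ρ₂, hσ, hd⟩ := h
  refine ⟨fun g => hr _, n, ρ₁.comp φ, ρ₂.comp φ, ?_, fun g => hd _⟩
  rw [hσ]
  rfl

/-- The group spanned by the functions `Ind_H^G (σ ∘ φ)` with `φ` a surjection from `H` onto a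
basic group and `σ` balanced. -/
def basicSpan (G : Type u) [Group G] [Finite G] : AddSubgroup (G → ℂ) :=
  AddSubgroup.closure {χ | ∃ (H : Subgroup G) (Q : Type u) (_ : Group Q) (φ : H →* Q) (σ : Q → ℂ),
    Function.Surjective φ ∧ IsBasicGroup Q ∧ IsBalanced σ ∧ χ = ind H (σ ∘ φ)}

theorem ind_mem_basicSpan {G : Type u} [Group G] [Finite G] (M : Subgroup G) {χ : M → ℂ}
    (h : χ ∈ basicSpan M) : ind M χ ∈ basicSpan G := by
  induction h using AddSubgroup.closure_induction with
  | mem χ h =>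
    obtain ⟨H, Q, _, φ, σ, hφ, hQ, hσ, rfl⟩ := h
    rw [ind_ind]
    let e := H.equivMapOfInjective M.subtype M.subtype_injective
    exact AddSubgroup.subset_closure ⟨_, Q, _, φ.comp e.symm.toMonoidHom, σ,
      hφ.comp e.symm.surjective, hQ, hσ, rfl⟩
  | zero => rw [map_zero]; exact zero_mem _
  | add x y _ _ hx hy => rw [map_add]; exact add_mem hx hy
  | neg x _ hx => rw [map_neg]; exact neg_mem hx

theorem comp_mem_basicSpan {G G' : Type u} [Group G] [Finite G] [Group G'] [Finite G']
    {φ : G →* G'} (hφ : Function.Surjective φ) {χ : G' → ℂ} (h : χ ∈ basicSpan G') :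
    χ ∘ φ ∈ basicSpan G := by
  induction h using AddSubgroup.closure_induction with
  | mem χ h =>
    obtain ⟨H, Q, _, ψ, σ, hψ, hQ, hσ, rfl⟩ := h
    rw [ind_comp hφ]
    exact AddSubgroup.subset_closure ⟨_, Q, _, ψ.comp (φ.subgroupComap H), σ,
      hψ.comp (φ.subgroupComap_surjective_of_surjective H hφ), hQ, hσ, rfl⟩
  | zero => exact zero_mem _
  | add x y _ _ hx hy => exact add_mem hx hy
  | neg x _ hx => exact neg_mem hx

theorem conj_invariant_of_character {G : Type*} [Group G] {V : Type*} [AddCommGroup V] [Module ℂ V]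
    (ρ : Representation ℂ G V) (x g : G) : ρ.character (x⁻¹ * g * x) = ρ.character g := by
  simpa using ρ.char_conj g x⁻¹

theorem IsBalanced.conj_invariant {Q : Type*} [Group Q] {σ : Q → ℂ} (h : IsBalanced σ)
    (x g : Q) : σ (x⁻¹ * g * x) = σ g := by
  obtain ⟨hr, n, ρ₁, ρ₂, rfl, hd⟩ := h
  simp only [Pi.sub_apply, conj_invariant_of_character]

theorem IsBalanced.mem_basicSpan {G : Type u} [Group G] [Finite G] (hG : IsBasicGroup G)
    {σ : G → ℂ} (h : IsBalanced σ) : σ ∈ basicSpan G := by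
  refine AddSubgroup.subset_closure ⟨⊤, G, _, (⊤ : Subgroup G).subtype, σ, fun g => ⟨⟨g, trivial⟩, rfl⟩,
    hG, h, ?_⟩
  exact (ind_top h.conj_invariant).symm

/-- This is the link between the axioms on `P` and the internal span: balanced functions satisfy
every requirement on `τ`, also after inflation. -/
theorem basicSpan_subset {G : Type u} [Group G] [Fintype G] (P : Set (G → ℂ))
    (hInd : ∀ (H : Subgroup G) (τ : H → ℂ),
      IsGeneralisedCharacter τ → IsRealValued τ → degree τ = 0 → HasTrivialDeterminant τ →
      FactorsThroughBasicQuotient τ → induced H τ ∈ P)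
    (hLin : ∀ (k : ℕ) (τ : Fin k → G → ℂ) (n : Fin k → ℤ),
      (∀ i, τ i ∈ P) → ∑ i, n i • τ i ∈ P) {χ : G → ℂ} (h : χ ∈ basicSpan G) : χ ∈ P := by
  have hgen : ∀ {Q : Type u} [Group Q] [Finite Q] {σ : Q → ℂ}, IsBalanced σ →
      IsGeneralisedCharacter σ := by
    rintro Q _ _ σ ⟨-, n, ρ₁, ρ₂, rfl, -⟩
    exact sub_mem (isGeneralisedCharacter_character ρ₁) (isGeneralisedCharacter_character ρ₂)
  induction h using AddSubgroup.closure_induction with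
  | mem χ h =>
    obtain ⟨H, Q, _, φ, σ, hφ, hQ, hσ, rfl⟩ := h
    rw [← induced_eq_ind]
    have hτ := hσ.comp φ
    refine hInd H _ (hgen hτ) hτ.1 ?_ ?_ ?_
    · obtain ⟨-, n, ρ₁, ρ₂, h, -⟩ := hτ
      rw [degree, h]
      simp
    · obtain ⟨-, n, ρ₁, ρ₂, h, hd⟩ := hτ
      exact ⟨n, n, ρ₁, ρ₂, h, fun g => (mul_conj_det_eq_one_iff ρ₁ ρ₂ g).2 (hd g)⟩
    · let e := QuotientGroup.quotientKerEquivOfSurjective φ hφ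
      exact ⟨φ.ker, inferInstance, hQ.of_mulEquiv e.symm, σ ∘ e, hgen (hσ.comp e.toMonoidHom),
        fun g => rfl⟩
  | zero => simpa using hLin 0 ![] ![] (fun i => i.elim0)
  | add x y _ _ hx hy =>
    simpa using hLin 2 ![x, y] ![1, 1] (fun i => by fin_cases i <;> simpa)
  | neg x _ hx => simpa using hLin 1 ![x] ![-1] (fun i => by fin_cases i; simpa)

/-! ### Constructions with actions -/

section Actions

variable {G : Type*} [Group G] {X Y : Type*}

theorem permChar_congr {a : G →* Equiv.Perm X} {b : G →* Equiv.Perm Y} (e : X ≃ Y)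
    (h : ∀ g x, e (a g x) = b g (e x)) : permChar a = permChar b := by
  ext g
  rw [permChar, permChar]
  congr 1
  exact Nat.card_congr (e.subtypeEquiv fun x => by rw [← h, e.apply_eq_iff_eq])

theorem permChar_conj (a : G →* Equiv.Perm X) (x g : G) :
    permChar a (x⁻¹ * g * x) = permChar a g := by
  rw [permChar, permChar]
  congr 1
  refine Nat.card_congr ((a x).subtypeEquiv fun y => ?_)
  rw [map_mul, map_mul, map_inv, Equiv.Perm.mul_apply, Equiv.Perm.mul_apply,
    Equiv.Perm.inv_eq_iff_eq]

theorem sgn_comp {H : Type*} [Group H] [Finite X] (φ : H →* G) (a : G →* Equiv.Perm X) :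
    sgn (a.comp φ) = (sgn a).comp φ := rfl

theorem sgn_eq_one_of_odd [Finite X] (a : G →* Equiv.Perm X) {g : G} {n : ℕ} (hn : Odd n)
    (hg : g ^ n = 1) : sgn a g = 1 := by
  have h : sgn a g ^ n = 1 := by rw [← map_pow, hg, map_one]
  rcases Int.units_eq_one_or (sgn a g) with h1 | h1
  · exact h1
  · rw [h1, hn.neg_one_pow] at h
    exact absurd h (by decide)

theorem permChar_trivial [Finite X] : permChar (1 : G →* Equiv.Perm X) = fun _ => (Nat.card X : ℂ) := by
  ext g
  rw [permChar]
  congr 1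
  exact Nat.card_congr (Equiv.subtypeUnivEquiv fun x => by simp)

theorem sgn_trivial [Finite X] : sgn (1 : G →* Equiv.Perm X) = 1 := by
  have := Fintype.ofFinite X
  classical
  ext g
  rw [sgn_apply]
  simp

/-- The disjoint union of two actions. -/
def sumAct (a : G →* Equiv.Perm X) (b : G →* Equiv.Perm Y) : G →* Equiv.Perm (X ⊕ Y) :=
  (Equiv.Perm.sumCongrHom X Y).comp (a.prod b)

theorem permChar_sumAct [Finite X] [Finite Y] (a : G →* Equiv.Perm X) (b : G →* Equiv.Perm Y) :
    permChar (sumAct a b) = permChar a + permChar b := by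
  ext g
  rw [Pi.add_apply, permChar, permChar, permChar, ← Nat.cast_add, ← Nat.card_sum]
  congr 1
  refine Nat.card_congr ((Equiv.subtypeSum).trans (Equiv.sumCongr ?_ ?_))
  · exact Equiv.subtypeEquivRight fun x => by simp [sumAct]
  · exact Equiv.subtypeEquivRight fun x => by simp [sumAct]

theorem sgn_sumAct [Finite X] [Finite Y] (a : G →* Equiv.Perm X) (b : G →* Equiv.Perm Y) :
    sgn (sumAct a b) = sgn a * sgn b := by
  have := Fintype.ofFinite X
  have := Fintype.ofFinite Y
  classical
  ext g
  rw [MonoidHom.mul_apply, sgn_apply, sgn_apply, sgn_apply]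
  simp [sumAct, Equiv.Perm.sign_sumCongr]

/-- The product of two actions. -/
def prodAct (a : G →* Equiv.Perm X) (b : G →* Equiv.Perm Y) : G →* Equiv.Perm (X × Y) where
  toFun g := Equiv.prodCongr (a g) (b g)
  map_one' := by ext x <;> simp
  map_mul' g h := by ext x <;> simp

theorem permChar_prodAct (a : G →* Equiv.Perm X) (b : G →* Equiv.Perm Y) :
    permChar (prodAct a b) = permChar a * permChar b := by
  ext g
  rw [Pi.mul_apply, permChar, permChar, permChar, ← Nat.cast_mul, ← Nat.card_prod]
  congr 1
  refine Nat.card_congr ((Equiv.subtypeEquivRight fun x => ?_).trans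
    (Equiv.subtypeProdEquivProd (p := fun x => a g x = x) (q := fun x => b g x = x)))
  simp [prodAct, Prod.ext_iff]

theorem sgn_prodAct [Finite X] [Finite Y] (a : G →* Equiv.Perm X) (b : G →* Equiv.Perm Y) (g : G) :
    sgn (prodAct a b) g = sgn a g ^ Nat.card Y * sgn b g ^ Nat.card X := by
  have := Fintype.ofFinite X
  have := Fintype.ofFinite Y
  classical
  have h : prodAct a b g = (Equiv.prodCongrLeft fun _ : Y => a g : Equiv.Perm (X × Y)) *
      (Equiv.prodCongrRight fun _ : X => b g : Equiv.Perm (X × Y)) := by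
    ext x <;> simp [prodAct]
  rw [sgn_apply, h, map_mul, Equiv.Perm.sign_prodCongrLeft, Equiv.Perm.sign_prodCongrRight,
    Finset.prod_const, Finset.prod_const, ← sgn_apply, ← sgn_apply]
  simp [Nat.card_eq_fintype_card]

/-- The action on a two-element set through a sign character. -/
def signAct (s : G →* ℤˣ) : G →* Equiv.Perm ℤˣ := (MulAction.toPermHom ℤˣ ℤˣ).comp s

theorem permChar_signAct (s : G →* ℤˣ) : permChar (signAct s) = fun g => 1 + ((s g : ℤ) : ℂ) := by
  ext g
  rw [permChar]
  rcases Int.units_eq_one_or (s g) with h | h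
  · have : Nat.card {x // signAct s g x = x} = 2 := by
      rw [Nat.card_congr (Equiv.subtypeUnivEquiv (p := fun x => signAct s g x = x)
        fun x => by simp [signAct, h])]
      rw [Nat.card_eq_fintype_card]; rfl
    rw [this, h]; norm_num
  · have : Nat.card {x // signAct s g x = x} = 0 := by
      rw [Nat.card_eq_zero]
      left
      refine ⟨fun x => ?_⟩
      have := x.2
      simp only [signAct, MonoidHom.comp_apply, h, MulAction.toPermHom_apply,
        MulAction.toPerm_apply] at this
      rcases Int.units_eq_one_or x.1 with h1 | h1 <;> rw [h1] at this <;>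
        exact absurd this (by decide)
    rw [this, h]; norm_num

theorem sgn_signAct (s : G →* ℤˣ) : sgn (signAct s) = s := by
  ext1 g
  rw [sgn_apply]
  have : ∀ v : ℤˣ, Equiv.Perm.sign (MulAction.toPermHom ℤˣ ℤˣ v) = v := by decide
  exact this _

theorem permChar_permCongr {X' : Type*} (e : X ≃ X') (a : G →* Equiv.Perm X) :
    permChar (e.permCongrHom.toMonoidHom.comp a) = permChar a :=
  (permChar_congr e fun g x => by simp).symm

theorem sgn_permCongr {X' : Type*} [Finite X] [Finite X'] (e : X ≃ X') (a : G →* Equiv.Perm X) :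
    sgn (e.permCongrHom.toMonoidHom.comp a) = sgn a := by
  have := Fintype.ofFinite X
  have := Fintype.ofFinite X'
  classical
  ext1 g
  rw [sgn_apply, sgn_apply]
  exact Equiv.Perm.sign_permCongr e (a g)

/-- The permutation characters of degree `0` and trivial determinant, as formal differences. -/
def IsPermZero (χ : G → ℂ) : Prop :=
  ∃ (n : ℕ) (a b : G →* Equiv.Perm (Fin n)), sgn a = sgn b ∧ χ = permChar a - permChar b

theorem isPermZero_sub [Finite X] [Finite Y] {a : G →* Equiv.Perm X} {b : G →* Equiv.Perm Y}
    (hcard : Nat.card X = Nat.card Y) (h : sgn a = sgn b) :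
    IsPermZero (permChar a - permChar b) := by
  refine ⟨Nat.card X, (Finite.equivFin X).permCongrHom.toMonoidHom.comp a,
    (Finite.equivFinOfCardEq hcard.symm).permCongrHom.toMonoidHom.comp b, ?_, ?_⟩
  · rw [sgn_permCongr, sgn_permCongr, h]
  · rw [permChar_permCongr, permChar_permCongr]

theorem IsPermZero.comp {H : Type*} [Group H] {χ : G → ℂ} (h : IsPermZero χ) (φ : H →* G) :
    IsPermZero (χ ∘ φ) := by
  obtain ⟨n, a, b, hs, rfl⟩ := h
  exact ⟨n, a.comp φ, b.comp φ, by rw [sgn_comp, sgn_comp, hs], rfl⟩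

/-- The sign of a product action depends only on the signs and sizes of the factors. This stability
is what allows the induction on supports in `isGoodGroup`. -/
theorem IsPermZero.mul_permChar [Finite X] {χ : G → ℂ} (h : IsPermZero χ)
    (c : G →* Equiv.Perm X) : IsPermZero (permChar c * χ) := by
  obtain ⟨n, a, b, hs, rfl⟩ := h
  rw [mul_sub, ← permChar_prodAct, ← permChar_prodAct]
  refine isPermZero_sub (by simp) ?_
  ext1 g
  rw [sgn_prodAct, sgn_prodAct, hs]

theorem IsPermZero.add {χ ψ : G → ℂ} (h : IsPermZero χ) (h' : IsPermZero ψ) :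
    IsPermZero (χ + ψ) := by
  obtain ⟨n, a, b, hs, rfl⟩ := h
  obtain ⟨m, c, d, ht, rfl⟩ := h'
  rw [sub_add_sub_comm, ← permChar_sumAct, ← permChar_sumAct]
  refine isPermZero_sub (by simp) ?_
  rw [sgn_sumAct, sgn_sumAct, hs, ht]

theorem IsPermZero.neg {χ : G → ℂ} (h : IsPermZero χ) : IsPermZero (-χ) := by
  obtain ⟨n, a, b, hs, rfl⟩ := h
  exact ⟨n, b, a, hs.symm, by abel⟩

theorem IsPermZero.isBalanced {χ : G → ℂ} (h : IsPermZero χ) : IsBalanced χ := by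
  obtain ⟨n, a, b, hs, rfl⟩ := h
  refine ⟨fun g => by simp [permChar], n, permRep a, permRep b, ?_, fun g => ?_⟩
  · rw [permRep_character, permRep_character]
  · rw [permRep_det, permRep_det, hs]

theorem IsPermZero.sub {χ ψ : G → ℂ} (h : IsPermZero χ) (h' : IsPermZero ψ) :
    IsPermZero (χ - ψ) := by
  rw [sub_eq_add_neg]
  exact h.add h'.neg

end Actions

/-! ### Induced actions -/

section IndPerm

variable {G : Type*} [Group G] {X Y : Type*} (M : Subgroup G)

/-- The cocycle `G × G/M → M` of a choice of coset representatives. -/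
def cosetCocycle (g : G) (c : G ⧸ M) : M :=
  ⟨(g • c).out⁻¹ * g * c.out, by
    rw [mul_assoc, ← QuotientGroup.eq, QuotientGroup.out_eq', ← smul_eq_mul,
      ← MulAction.Quotient.smul_coe, QuotientGroup.out_eq']⟩

theorem cosetCocycle_mul (g h : G) (c : G ⧸ M) :
    cosetCocycle M (g * h) c = cosetCocycle M g (h • c) * cosetCocycle M h c := by
  ext
  simp only [cosetCocycle, Subgroup.coe_mul, mul_smul]
  group

theorem cosetCocycle_one (c : G ⧸ M) : cosetCocycle M 1 c = 1 := by
  ext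
  simp [cosetCocycle]

variable {M}

/-- The action of `G` induced from an action of the subgroup `M`. -/
def indPerm (a : M →* Equiv.Perm X) : G →* Equiv.Perm ((G ⧸ M) × X) :=
  MonoidHom.toHomPerm
    { toFun := fun g => fun y => (g • y.1, a (cosetCocycle M g y.1) y.2)
      map_one' := by
        funext y
        simp [cosetCocycle_one]
        rfl
      map_mul' := fun g h => by
        funext y
        simp [cosetCocycle_mul, mul_smul]
        rfl }

theorem indPerm_apply (a : M →* Equiv.Perm X) (g : G) (y : (G ⧸ M) × X) :
    indPerm a g y = (g • y.1, a (cosetCocycle M g y.1) y.2) := rfl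

theorem smul_eq_iff_conj_mem (g : G) (c : G ⧸ M) : g • c = c ↔ c.out⁻¹ * g * c.out ∈ M := by
  conv_lhs => rw [← QuotientGroup.out_eq' c, MulAction.Quotient.smul_coe, smul_eq_mul, eq_comm,
    QuotientGroup.eq, ← mul_assoc]

variable [Finite G]

/-- First move points inside each fibre by the cocycle, then permute the fibres; the second
permutation is `|X|` copies of the action on `G/M`. Thus `a` enters only through its size and its
sign. -/
theorem sgn_indPerm [Finite X] [Fintype (G ⧸ M)] [DecidableEq (G ⧸ M)] (a : M →* Equiv.Perm X)
    (g : G) : sgn (indPerm a) g = Equiv.Perm.sign (MulAction.toPermHom G (G ⧸ M) g) ^ Nat.card X *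
      ∏ k : G ⧸ M, sgn a (cosetCocycle M g k) := by
  classical
  have := Fintype.ofFinite X
  have h : indPerm a g =
      (Equiv.prodCongrLeft fun _ : X => MulAction.toPermHom G (G ⧸ M) g :
        Equiv.Perm ((G ⧸ M) × X)) *
      (Equiv.prodCongrRight fun k : G ⧸ M => a (cosetCocycle M g k) :
        Equiv.Perm ((G ⧸ M) × X)) := by
    ext y <;> simp [indPerm_apply]
  rw [sgn_apply, h, map_mul, Equiv.Perm.sign_prodCongrLeft, Equiv.Perm.sign_prodCongrRight,
    Finset.prod_const]
  simp [Nat.card_eq_fintype_card, sgn_apply]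

theorem sgn_indPerm_eq [Finite X] [Finite Y] {a : M →* Equiv.Perm X} {b : M →* Equiv.Perm Y}
    (hcard : Nat.card X = Nat.card Y) (h : sgn a = sgn b) : sgn (indPerm a) = sgn (indPerm b) := by
  classical
  have := Fintype.ofFinite (G ⧸ M)
  ext1 g
  rw [sgn_indPerm, sgn_indPerm, hcard, h]

variable (M) in
/-- The decomposition of a group into cosets, for the chosen representatives. -/
def groupEquivQuotientProd : G ≃ (G ⧸ M) × M where
  toFun x := (x, ⟨(x : G ⧸ M).out⁻¹ * x, by rw [← QuotientGroup.eq, QuotientGroup.out_eq']⟩)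
  invFun y := y.1.out * y.2
  left_inv x := by simp
  right_inv y := by
    have h : ((y.1.out * y.2 : G) : G ⧸ M) = y.1 := by
      rw [QuotientGroup.mk_mul_of_mem _ y.2.2, QuotientGroup.out_eq']
    ext
    · exact h
    · simp [h]

theorem ind_eq_sum_quotient [Fintype (G ⧸ M)] {τ : M → ℂ}
    (hτ : ∀ x g : M, τ (x⁻¹ * g * x) = τ g) (g : G) :
    ind M τ g = ∑ c : G ⧸ M, extendZero M τ (c.out⁻¹ * g * c.out) := by
  have := Fintype.ofFinite G
  have := Fintype.ofFinite M
  have hinv : ∀ (m : M) (z : G), extendZero M τ ((m : G)⁻¹ * z * m) = extendZero M τ z := by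
    intro m z
    by_cases hz : z ∈ M
    · rw [extendZero_of_mem _ hz,
        extendZero_of_mem _ (M.mul_mem (M.mul_mem (M.inv_mem m.2) hz) m.2)]
      exact hτ m ⟨z, hz⟩
    · rw [extendZero_of_notMem _ hz, extendZero_of_notMem]
      intro h
      refine hz ?_
      have := M.mul_mem (M.mul_mem m.2 h) (M.inv_mem m.2)
      convert this using 1
      group
  rw [ind_apply, ← (groupEquivQuotientProd M).symm.sum_comp,
    Fintype.sum_prod_type]
  have : ∀ (c : G ⧸ M) (m : M), extendZero M τ
      (((groupEquivQuotientProd M).symm (c, m))⁻¹ * g *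
        (groupEquivQuotientProd M).symm (c, m)) =
      extendZero M τ (c.out⁻¹ * g * c.out) := by
    intro c m
    have h : (groupEquivQuotientProd M).symm (c, m) = c.out * m := rfl
    rw [h, ← hinv m (c.out⁻¹ * g * c.out)]
    congr 1
    group
  simp only [this, Finset.sum_const, Finset.card_univ, nsmul_eq_mul, ← Nat.card_eq_fintype_card]
  rw [← Finset.mul_sum]
  have : (Nat.card M : ℂ) ≠ 0 := by exact_mod_cast Nat.card_pos.ne'
  field_simp

/-- Fixed points lie over fixed cosets, and over a fixed coset `c` the cocycle is the conjugate of
`g` by the representative of `c`. -/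
theorem permChar_indPerm [Finite X] (a : M →* Equiv.Perm X) :
    permChar (indPerm a) = ind M (permChar a) := by
  classical
  have := Fintype.ofFinite (G ⧸ M)
  ext g
  rw [ind_eq_sum_quotient (permChar_conj a), permChar]
  have e : {y // indPerm a g y = y} ≃ Σ c : G ⧸ M, {x // indPerm a g (c, x) = (c, x)} :=
    { toFun := fun y => ⟨y.1.1, y.1.2, y.2⟩
      invFun := fun z => ⟨(z.1, z.2.1), z.2.2⟩
      left_inv := fun _ => rfl
      right_inv := fun _ => rfl }
  rw [Nat.card_congr e, Nat.card_sigma, Nat.cast_sum]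
  refine Finset.sum_congr rfl fun c _ => ?_
  by_cases h : g • c = c
  · rw [extendZero_of_mem _ ((smul_eq_iff_conj_mem g c).1 h), permChar]
    congr 1
    refine Nat.card_congr (Equiv.subtypeEquivRight fun x => ?_)
    rw [indPerm_apply, Prod.mk.injEq]
    have : cosetCocycle M g c = ⟨_, (smul_eq_iff_conj_mem g c).1 h⟩ := by
      ext
      simp [cosetCocycle, h]
    simp [h, this]
  · rw [extendZero_of_notMem _ (mt (smul_eq_iff_conj_mem g c).2 h)]
    rw [Nat.cast_eq_zero, Nat.card_eq_zero]
    left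
    refine ⟨fun x => h ?_⟩
    exact congrArg Prod.fst x.2

/-- The action on the cosets of a subgroup. -/
def cosetPerm (H : Subgroup G) : G →* Equiv.Perm (G ⧸ H) := MulAction.toPermHom G (G ⧸ H)

theorem permChar_cosetPerm (H : Subgroup G) : permChar (cosetPerm H) = ind H 1 := by
  have : (1 : H → ℂ) = permChar (1 : H →* Equiv.Perm Unit) := by
    rw [permChar_trivial]
    ext; simp
  rw [this, ← permChar_indPerm]
  exact permChar_congr (Equiv.prodPUnit _).symm fun g x => rfl

end IndPerm

theorem IsPermZero.mem_basicSpan {G : Type u} [Group G] [Finite G] (hG : IsBasicGroup G)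
    {χ : G → ℂ} (h : IsPermZero χ) : χ ∈ basicSpan G :=
  h.isBalanced.mem_basicSpan hG

/-! ### Groups of order dividing four -/

theorem isBasicGroup_of_card_eq_four {Q : Type*} [Group Q] (hQ : Nat.card Q = 4) :
    IsBasicGroup Q := by
  have : Finite Q := Nat.finite_of_card_ne_zero (by rw [hQ]; norm_num)
  by_cases hc : IsCyclic Q
  · exact Or.inl hc
  · have hsq : ∀ x : Q, x ^ 2 = 1 := by
      intro x
      have hd : orderOf x ∣ 2 ^ 2 := by
        have := orderOf_dvd_natCard x
        rwa [hQ] at this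
      obtain ⟨k, hk, hx⟩ := (Nat.dvd_prime_pow Nat.prime_two).1 hd
      interval_cases k
      · exact orderOf_dvd_iff_pow_eq_one.1 (by rw [hx]; norm_num)
      · exact orderOf_dvd_iff_pow_eq_one.1 (by rw [hx]; norm_num)
      · exact absurd (isCyclic_of_orderOf_eq_card x (by rw [hx, hQ]; norm_num)) hc
    have hexp : Monoid.exponent Q = 2 := by
      have hd : Monoid.exponent Q ∣ 2 := Monoid.exponent_dvd_of_forall_pow_eq_one hsq
      rcases (Nat.dvd_prime Nat.prime_two).1 hd with h | h
      · rw [Monoid.exp_eq_one_iff] at h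
        rw [Nat.card_eq_one_iff_unique.2 ⟨h, inferInstance⟩] at hQ
        norm_num at hQ
      · exact h
    have : IsKleinFour Q := ⟨hQ, hexp⟩
    have : IsAddKleinFour (ZMod 2 × ZMod 2) := inferInstance
    have : IsKleinFour (Multiplicative (ZMod 2 × ZMod 2)) := inferInstance
    obtain ⟨e⟩ := IsKleinFour.nonempty_mulEquiv (G₁ := Q)
      (G₂ := Multiplicative (ZMod 2 × ZMod 2))
    exact Or.inr (Or.inl ⟨e.trans (MulEquiv.prodMultiplicative _ _)⟩)

theorem isBasicGroup_of_injective_units_prod {Q : Type*} [Group Q] {φ : Q →* ℤˣ × ℤˣ}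
    (hφ : Function.Injective φ) : IsBasicGroup Q := by
  have : Finite Q := Finite.of_injective φ hφ
  have hcard : Nat.card Q ∣ 4 := by
    have h := Subgroup.card_dvd_of_injective φ hφ
    have h4 : Nat.card (ℤˣ × ℤˣ) = 4 := by
      rw [Nat.card_eq_fintype_card]; rfl
    rwa [h4] at h
  have hle := Nat.le_of_dvd (by norm_num) hcard
  have hpos : 0 < Nat.card Q := Nat.card_pos
  interval_cases hQ : Nat.card Q
  · have := (Nat.card_eq_one_iff_unique.1 hQ).1
    exact Or.inl inferInstance
  · have : Fact (Nat.Prime 2) := ⟨Nat.prime_two⟩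
    exact Or.inl (isCyclic_of_prime_card hQ)
  · norm_num at hcard
  · exact isBasicGroup_of_card_eq_four hQ

/-! ### Sign characters, localisation at a prime, and good actions -/

section

variable {G : Type u} [Group G]

/-- A sign character as a complex function. -/
def signFun (s : G →* ℤˣ) : G → ℂ := fun g => ((s g : ℤ) : ℂ)

/-- The two-point action through `s` has character `1 + s` and sign `s`; two trivial points equalise
the degrees. -/
theorem isPermZero_signFun (s t : G →* ℤˣ) :
    IsPermZero (1 + signFun (s * t) - signFun s - signFun t) := by
  have h := isPermZero_sub (a := sumAct (signAct (s * t)) (1 : G →* Equiv.Perm (Fin 2)))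
    (b := sumAct (signAct s) (signAct t)) (by simp) (by
      rw [sgn_sumAct, sgn_sumAct, sgn_signAct, sgn_signAct, sgn_signAct, sgn_trivial, mul_one])
  convert h using 1
  rw [permChar_sumAct, permChar_sumAct, permChar_signAct, permChar_signAct, permChar_signAct,
    permChar_trivial]
  ext g
  simp [signFun]
  ring

variable [Finite G]

/-- The pair `(s, t)` factors through a quotient that embeds in `C₂ × C₂`, hence is basic. -/
theorem signFun_mem_basicSpan (s t : G →* ℤˣ) :
    1 + signFun (s * t) - signFun s - signFun t ∈ basicSpan G := by
  let φ := s.prod t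
  have hQ : IsBasicGroup (G ⧸ φ.ker) :=
    isBasicGroup_of_injective_units_prod (QuotientGroup.kerLift_injective φ)
  let s' : G ⧸ φ.ker →* ℤˣ := (MonoidHom.fst _ _).comp (QuotientGroup.kerLift φ)
  let t' : G ⧸ φ.ker →* ℤˣ := (MonoidHom.snd _ _).comp (QuotientGroup.kerLift φ)
  exact comp_mem_basicSpan (φ := QuotientGroup.mk' φ.ker) (QuotientGroup.mk'_surjective _)
    ((isPermZero_signFun s' t').mem_basicSpan hQ)

variable (p : ℕ) [hp : Fact p.Prime]

/-- The functions which have a multiple by an integer prime to `p` in `basicSpan`. -/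
def localSpan (G : Type u) [Group G] [Finite G] : AddSubgroup (G → ℂ) where
  carrier := {χ | ∃ n : ℕ, ¬ p ∣ n ∧ n • χ ∈ basicSpan G}
  zero_mem' := ⟨1, hp.1.one_lt.ne' ∘ Nat.dvd_one.1, by rw [smul_zero]; exact zero_mem _⟩
  add_mem' := by
    rintro x y ⟨n, hn, hx⟩ ⟨m, hm, hy⟩
    refine ⟨n * m, fun h => (hp.1.dvd_mul.1 h).elim hn hm, ?_⟩
    rw [smul_add]
    refine add_mem ?_ ?_
    · rw [mul_comm, mul_smul]
      exact AddSubgroup.nsmul_mem _ hx m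
    · rw [mul_smul]
      exact AddSubgroup.nsmul_mem _ hy n
  neg_mem' := by
    rintro x ⟨n, hn, hx⟩
    exact ⟨n, hn, by rw [smul_neg]; exact neg_mem hx⟩

variable {p}

theorem basicSpan_le_localSpan : basicSpan G ≤ localSpan p G := fun χ h =>
  ⟨1, hp.1.one_lt.ne' ∘ Nat.dvd_one.1, by rwa [one_smul]⟩

theorem mem_localSpan_of_nsmul {χ : G → ℂ} {n : ℕ} (hn : ¬ p ∣ n) (h : n • χ ∈ localSpan p G) :
    χ ∈ localSpan p G := by
  obtain ⟨m, hm, h⟩ := h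
  exact ⟨m * n, fun h => (hp.1.dvd_mul.1 h).elim hm hn, by rwa [mul_smul]⟩

theorem ind_mem_localSpan (M : Subgroup G) {χ : M → ℂ} (h : χ ∈ localSpan p M) :
    ind M χ ∈ localSpan p G := by
  obtain ⟨n, hn, h⟩ := h
  exact ⟨n, hn, by rw [← map_nsmul]; exact ind_mem_basicSpan M h⟩

theorem comp_mem_localSpan {G' : Type u} [Group G'] [Finite G'] {φ : G →* G'}
    (hφ : Function.Surjective φ) {χ : G' → ℂ} (h : χ ∈ localSpan p G') :
    χ ∘ φ ∈ localSpan p G := by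
  obtain ⟨n, hn, h⟩ := h
  exact ⟨n, hn, comp_mem_basicSpan hφ h⟩

/-- The integers `n` with `n • χ` in the span form an ideal of `ℤ`; by hypothesis it lies in no
`pℤ`, so it is everything. -/
theorem mem_basicSpan_of_forall_localSpan {χ : G → ℂ}
    (h : ∀ (p : ℕ) [Fact p.Prime], χ ∈ localSpan p G) : χ ∈ basicSpan G := by
  let I : AddSubgroup ℤ := (basicSpan G).comap (zmultiplesHom _ χ)
  have hI : ∀ n : ℤ, n ∈ I ↔ n • χ ∈ basicSpan G := fun n => Iff.rfl
  obtain ⟨d, hd⟩ := Int.subgroup_cyclic I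
  by_cases h1 : d.natAbs = 1
  · have : (1 : ℤ) ∈ I := by
      rw [hd, AddSubgroup.mem_closure_singleton]
      rcases Int.natAbs_eq d with h2 | h2
      · exact ⟨1, by rw [h2, h1]; simp⟩
      · exact ⟨-1, by rw [h2, h1]; simp⟩
    simpa using (hI 1).1 this
  · obtain ⟨p, hp, hpd⟩ := Nat.exists_prime_and_dvd h1
    have : Fact p.Prime := ⟨hp⟩
    obtain ⟨n, hn, hχ⟩ := h p
    exfalso
    refine hn ?_
    have hn' : (n : ℤ) ∈ I := (hI n).2 (by simpa using hχ)
    rw [hd, AddSubgroup.mem_closure_singleton] at hn'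
    obtain ⟨k, hk⟩ := hn'
    have hdn : d ∣ (n : ℤ) := ⟨k, by rw [← hk, smul_eq_mul, mul_comm]⟩
    exact Int.natCast_dvd_natCast.1 ((Int.natCast_dvd.2 hpd).trans hdn)

variable (p) in
/-- The action `a` is good at `p`: its permutation character, corrected to have degree `0` and
trivial determinant, lies in `localSpan`. -/
def IsGood {X : Type*} [Finite X] (a : G →* Equiv.Perm X) : Prop :=
  permChar a - (fun _ => (Nat.card X : ℂ) - 1) - signFun (sgn a) ∈ localSpan p G

theorem isPermZero_correction {X : Type*} [Finite X] (a : G →* Equiv.Perm X) :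
    IsPermZero (permChar a - (fun _ => (Nat.card X : ℂ) - 1) - signFun (sgn a)) := by
  have h := isPermZero_sub (a := sumAct a (1 : G →* Equiv.Perm (Fin 2)))
    (b := sumAct (signAct (sgn a)) (1 : G →* Equiv.Perm X)) (by simp [add_comm]) (by
      rw [sgn_sumAct, sgn_sumAct, sgn_signAct, sgn_trivial, sgn_trivial])
  convert h using 1
  rw [permChar_sumAct, permChar_sumAct, permChar_signAct, permChar_trivial, permChar_trivial]
  ext g
  simp [signFun]
  ring

theorem IsGood.congr {X Y : Type*} [Finite X] [Finite Y] {a : G →* Equiv.Perm X}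
    {b : G →* Equiv.Perm Y} (hb : IsGood p b) (hcard : Nat.card X = Nat.card Y)
    (hs : sgn a = sgn b) (h : permChar a - permChar b ∈ localSpan p G) : IsGood p a := by
  have := add_mem hb h
  rw [IsGood, hs, hcard]
  convert this using 1
  abel

theorem IsGood.of_permChar_eq {X Y : Type*} [Finite X] [Finite Y] {a : G →* Equiv.Perm X}
    {b : G →* Equiv.Perm Y} (hb : IsGood p b) (h : permChar a = permChar b) : IsGood p a := by
  refine hb.congr ?_ ?_ ?_
  · have := congrFun h 1
    rw [permChar_one, permChar_one] at this
    exact_mod_cast this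
  · ext1 g
    exact sgn_eq_of_permChar_eq fun k => congrFun h _
  · rw [h, sub_self]
    exact zero_mem _

theorem isGood_trivial {X : Type*} [Finite X] : IsGood p (1 : G →* Equiv.Perm X) := by
  rw [IsGood, permChar_trivial, sgn_trivial]
  convert zero_mem (localSpan p G) using 1
  ext g
  simp [signFun]

/-- The correction terms fail to be additive only by `1 + st - s - t` with `s`, `t` the two signs.
Hence goodness is additive and summands can be cancelled. -/
theorem isGood_sumAct_sub {X Y : Type*} [Finite X] [Finite Y] (a : G →* Equiv.Perm X)
    (b : G →* Equiv.Perm Y) :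
    (permChar (sumAct a b) - (fun _ => (Nat.card (X ⊕ Y) : ℂ) - 1) - signFun (sgn (sumAct a b))) -
      (permChar a - (fun _ => (Nat.card X : ℂ) - 1) - signFun (sgn a)) -
      (permChar b - (fun _ => (Nat.card Y : ℂ) - 1) - signFun (sgn b)) ∈ localSpan p G := by
  have := basicSpan_le_localSpan (p := p) (neg_mem (signFun_mem_basicSpan (sgn a) (sgn b)))
  convert this using 1
  rw [permChar_sumAct, sgn_sumAct]
  ext g
  simp
  ring

theorem IsGood.sumAct {X Y : Type*} [Finite X] [Finite Y] {a : G →* Equiv.Perm X}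
    {b : G →* Equiv.Perm Y} (ha : IsGood p a) (hb : IsGood p b) : IsGood p (sumAct a b) := by
  have := add_mem (add_mem (isGood_sumAct_sub (p := p) a b) hb) ha
  rw [IsGood]
  convert this using 1
  abel

theorem IsGood.of_sumAct {X Y : Type*} [Finite X] [Finite Y] {a : G →* Equiv.Perm X}
    {b : G →* Equiv.Perm Y} (hab : IsGood p (CharInduction.sumAct a b)) (hb : IsGood p b) :
    IsGood p a := by
  have := sub_mem hab (add_mem (isGood_sumAct_sub (p := p) a b) hb)
  rw [IsGood]
  convert this using 1
  abel

variable (p) in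
/-- All permutation characters of `G` of degree `0` and trivial determinant lie in `localSpan`. -/
def IsGoodGroup (G : Type u) [Group G] [Finite G] : Prop :=
  ∀ χ : G → ℂ, IsPermZero χ → χ ∈ localSpan p G

theorem IsGoodGroup.isGood (h : IsGoodGroup p G) {X : Type*} [Finite X] (a : G →* Equiv.Perm X) :
    IsGood p a := h _ (isPermZero_correction a)

theorem isGoodGroup_of_isBasicGroup (h : IsBasicGroup G) : IsGoodGroup p G := fun _ hχ =>
  basicSpan_le_localSpan (hχ.mem_basicSpan h)

theorem card_fixed_eq_sum_orbits {X : Type*} [Finite X] (a : G →* Equiv.Perm X) :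
    ∃ (n : ℕ) (H : Fin n → Subgroup G), permChar a = ∑ i, permChar (cosetPerm (H i)) := by
  classical
  let _ : MulAction G X := MulAction.compHom X a
  have hsmul : ∀ (g : G) (x : X), g • x = a g x := fun g x => rfl
  let Ω := Quotient (MulAction.orbitRel G X)
  have := Fintype.ofFinite X
  have := Fintype.ofFinite Ω
  let n := Fintype.card Ω
  let e : Fin n ≃ Ω := (Fintype.equivFin Ω).symm
  refine ⟨n, fun i => MulAction.stabilizer G (e i).out, ?_⟩
  ext g
  rw [Finset.sum_apply, e.sum_comp fun ω => permChar (cosetPerm (MulAction.stabilizer G ω.out)) g,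
    permChar]
  have e' : {x // a g x = x} ≃ Σ ω : Ω, {x : X // a g x = x ∧ Quotient.mk _ x = ω} :=
    { toFun := fun x => ⟨Quotient.mk _ x.1, x.1, x.2, rfl⟩
      invFun := fun y => ⟨y.2.1, y.2.2.1⟩
      left_inv := fun _ => rfl
      right_inv := by rintro ⟨_, x, h, rfl⟩; rfl }
  rw [Nat.card_congr e', Nat.card_sigma, Nat.cast_sum]
  refine Finset.sum_congr rfl fun ω _ => ?_
  rw [permChar]
  congr 1
  have hmem : ∀ x : X, Quotient.mk _ x = ω ↔ x ∈ MulAction.orbit G ω.out := by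
    intro x
    conv_lhs => rw [← Quotient.out_eq ω, Quotient.eq]
    exact MulAction.orbitRel_apply
  let f := MulAction.orbitEquivQuotientStabilizer G ω.out
  have hf : ∀ (g : G) (c : G ⧸ MulAction.stabilizer G ω.out), (f.symm (g • c) : X) = g • (f.symm c : X) := by
    intro g c
    induction c using QuotientGroup.induction_on with
    | H z =>
      rw [MulAction.Quotient.smul_coe, MulAction.orbitEquivQuotientStabilizer_symm_apply,
        MulAction.orbitEquivQuotientStabilizer_symm_apply, smul_eq_mul, mul_smul]
  refine Nat.card_congr (Equiv.symm ⟨fun c => ⟨f.symm c.1, ?_, (hmem _).2 (f.symm c.1).2⟩,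
    fun x => ⟨f ⟨x.1, (hmem _).1 x.2.2⟩, ?_⟩, fun c => ?_, fun x => ?_⟩)
  · rw [← hsmul, ← hf]
    exact congrArg (fun c => (f.symm c : X)) c.2
  · change g • f _ = f _
    apply f.symm.injective
    apply Subtype.ext
    rw [hf, Equiv.symm_apply_apply]
    exact x.2.1
  · ext
    simp
  · ext
    simp

theorem exists_isGood_sum {ι : Type*} (S : Finset ι) {X : ι → Type*} [∀ i, Finite (X i)]
    (a : ∀ i, G →* Equiv.Perm (X i)) (h : ∀ i, IsGood p (a i)) :
    ∃ (m : ℕ) (b : G →* Equiv.Perm (Fin m)), IsGood p b ∧ permChar b = ∑ i ∈ S, permChar (a i) := by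
  classical
  induction S using Finset.induction_on with
  | empty =>
    refine ⟨0, 1, isGood_trivial, ?_⟩
    rw [permChar_trivial]
    ext; simp
  | insert i S hi ih =>
    obtain ⟨m, b, hb, hS⟩ := ih
    let c := sumAct (a i) b
    let e := Finite.equivFin (X i ⊕ Fin m)
    refine ⟨_, e.permCongrHom.toMonoidHom.comp c, ?_, ?_⟩
    · exact ((h i).sumAct hb).of_permChar_eq (permChar_permCongr e c)
    · rw [permChar_permCongr, permChar_sumAct, hS, Finset.sum_insert hi]

theorem isGood_of_forall_cosetPerm (h : ∀ H : Subgroup G, IsGood p (cosetPerm H)) {X : Type*}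
    [Finite X] (a : G →* Equiv.Perm X) : IsGood p a := by
  obtain ⟨n, H, hH⟩ := card_fixed_eq_sum_orbits a
  obtain ⟨m, b, hb, hS⟩ := exists_isGood_sum Finset.univ (fun i => cosetPerm (H i)) fun i => h _
  exact hb.of_permChar_eq (hH.trans hS.symm)

/-- For two actions of equal size and sign the correction terms cancel, and every action is a sum of
transitive ones. -/
theorem isGoodGroup_of_forall_cosetPerm (h : ∀ H : Subgroup G, IsGood p (cosetPerm H)) :
    IsGoodGroup p G := by
  rintro χ ⟨n, a, b, hs, rfl⟩
  have := sub_mem (isGood_of_forall_cosetPerm h a) (isGood_of_forall_cosetPerm h b)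
  rw [hs] at this
  convert this using 1
  abel

theorem isGood_of_quotient {X : Type*} [Finite X] (a : G →* Equiv.Perm X)
    (h : IsGoodGroup p (G ⧸ a.ker)) : IsGood p a :=
  comp_mem_localSpan (φ := QuotientGroup.mk' a.ker) (QuotientGroup.mk'_surjective _)
    (h.isGood (QuotientGroup.kerLift a))

end

section

variable {G : Type u} [Group G] [Finite G] {p : ℕ} [hp : Fact p.Prime]

theorem IsGood.of_permChar_eq_nsmul {X Y : Type*} [Finite X] [Finite Y] {a : G →* Equiv.Perm X}
    {b : G →* Equiv.Perm Y} (hb : IsGood p b) (n : ℕ) (h : permChar a = n • permChar b) :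
    IsGood p a := by
  obtain ⟨m, c, hc, hS⟩ := exists_isGood_sum (Finset.univ : Finset (Fin n)) (fun _ => b)
    (fun _ => hb)
  refine hc.of_permChar_eq ?_
  rw [h, hS]
  simp

/-! ### Goodness of induced actions -/

variable {M : Subgroup G}

theorem permChar_indPerm_sumAct {X Y : Type*} [Finite X] [Finite Y] (a : M →* Equiv.Perm X)
    (b : M →* Equiv.Perm Y) : permChar (indPerm (sumAct a b)) =
      permChar (sumAct (indPerm a) (indPerm b)) := by
  rw [permChar_indPerm, permChar_sumAct, permChar_sumAct, map_add, permChar_indPerm,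
    permChar_indPerm]

theorem permChar_indPerm_trivial {X : Type*} [Finite X] :
    permChar (indPerm (1 : M →* Equiv.Perm X)) = Nat.card X • permChar (cosetPerm M) := by
  rw [permChar_indPerm, permChar_trivial, permChar_cosetPerm, ← map_nsmul]
  congr 1
  ext
  simp

theorem IsGood.indPerm_trivial (h : IsGood p (cosetPerm M)) (X : Type*) [Finite X] :
    IsGood p (indPerm (1 : M →* Equiv.Perm X)) :=
  h.of_permChar_eq_nsmul _ permChar_indPerm_trivial

theorem isGood_indPerm_of_sgn_eq (hM : IsGoodGroup p M) {X Y : Type*} [Finite X] [Finite Y]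
    {a : M →* Equiv.Perm X} {b : M →* Equiv.Perm Y} (hcard : Nat.card X = Nat.card Y)
    (hs : sgn a = sgn b) (hb : IsGood p (indPerm b)) : IsGood p (indPerm a) := by
  refine hb.congr (by simp [Nat.card_prod, hcard]) (sgn_indPerm_eq hcard hs) ?_
  rw [permChar_indPerm, permChar_indPerm, ← map_sub]
  exact ind_mem_localSpan M (hM _ (isPermZero_sub hcard hs))

/-- Padded with trivial points, `a` has the same size and sign as `signAct (sgn a)`. After induction
the padding consists of copies of `G/M`, which cancel. -/
theorem isGood_indPerm_of_signAct (hM : IsGoodGroup p M) (hG : IsGood p (cosetPerm M))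
    (hs : ∀ s : M →* ℤˣ, IsGood p (indPerm (signAct s))) {X : Type*} [Finite X]
    (a : M →* Equiv.Perm X) : IsGood p (indPerm a) := by
  have hB : IsGood p (indPerm (sumAct (signAct (sgn a)) (1 : M →* Equiv.Perm X))) :=
    ((hs _).sumAct (hG.indPerm_trivial X)).of_permChar_eq (permChar_indPerm_sumAct _ _)
  have hA : IsGood p (indPerm (sumAct a (1 : M →* Equiv.Perm (Fin 2)))) := by
    refine isGood_indPerm_of_sgn_eq hM (by simp [add_comm]) ?_ hB
    rw [sgn_sumAct, sgn_sumAct, sgn_signAct, sgn_trivial, sgn_trivial]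
  exact (hA.of_permChar_eq (permChar_indPerm_sumAct _ _).symm).of_sumAct (hG.indPerm_trivial _)

theorem isGood_of_sumAct_self (h2 : p ≠ 2) {X : Type*} [Finite X] {a : G →* Equiv.Perm X}
    (h : IsGood p (sumAct a a)) : IsGood p a := by
  have hn : ¬ p ∣ 2 := fun h' => h2 ((Nat.prime_dvd_prime_iff_eq hp.1 Nat.prime_two).1 h')
  refine mem_localSpan_of_nsmul hn ?_
  have := sub_mem h (isGood_sumAct_sub (p := p) a a)
  convert this using 1
  rw [two_smul]
  abel

/-- Two copies of `a` have trivial sign, so they compare with a trivial action; for odd `p` the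
factor 2 is harmless. -/
theorem isGood_indPerm_of_ne_two (h2 : p ≠ 2) (hM : IsGoodGroup p M)
    (hG : IsGood p (cosetPerm M)) {X : Type*} [Finite X] (a : M →* Equiv.Perm X) :
    IsGood p (indPerm a) := by
  have hA : IsGood p (indPerm (sumAct a a)) := by
    refine isGood_indPerm_of_sgn_eq hM (b := (1 : M →* Equiv.Perm (X ⊕ X))) rfl ?_
      (hG.indPerm_trivial _)
    rw [sgn_sumAct, sgn_trivial]
    ext1 g
    exact Int.units_mul_self _
  exact isGood_of_sumAct_self h2 (hA.of_permChar_eq (permChar_indPerm_sumAct _ _).symm)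

theorem permChar_indPerm_cosetPerm (K : Subgroup M) :
    permChar (indPerm (cosetPerm K)) = permChar (cosetPerm (K.map M.subtype)) := by
  rw [permChar_indPerm, permChar_cosetPerm, permChar_cosetPerm, ind_ind]
  rfl

theorem isGood_cosetPerm_of_le {H : Subgroup G} (hHM : H ≤ M)
    (h : IsGood p (indPerm (cosetPerm (H.subgroupOf M)))) : IsGood p (cosetPerm H) := by
  refine h.of_permChar_eq ?_
  rw [permChar_indPerm_cosetPerm, Subgroup.map_subgroupOf_eq_of_le hHM]

theorem le_ker_cosetPerm {D M : Subgroup G} [D.Normal] (h : D ≤ M) : D ≤ (cosetPerm M).ker := by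
  rw [cosetPerm, ← Subgroup.normalCore_eq_ker]
  exact Subgroup.normal_le_normalCore.2 h

theorem exists_mem_of_permChar_cosetPerm_ne_zero {H : Subgroup G} {x : G}
    (h : permChar (cosetPerm H) x ≠ 0) : ∃ g : G, g⁻¹ * x * g ∈ H := by
  rw [permChar, Nat.cast_ne_zero, Nat.card_ne_zero] at h
  obtain ⟨⟨c, hc⟩⟩ := h.1
  exact ⟨c.out, (smul_eq_iff_conj_mem x c).1 hc⟩

end

/-! ### Small groups -/

/-- The action of the dihedral group of order `2n` on the vertices of the `n`-gon. -/
def dihedralPerm (n : ℕ) : DihedralGroup n →* Equiv.Perm (ZMod n) :=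
  MonoidHom.toHomPerm
    { toFun := fun g => match g with
        | DihedralGroup.r i => fun x => x - i
        | DihedralGroup.sr i => fun x => i - x
      map_one' := by
        funext x
        exact sub_zero x
      map_mul' := fun g h => by
        funext x
        rcases g with i | i <;> rcases h with j | j
        · change x - (i + j) = x - j - i
          ring
        · change j - i - x = j - x - i
          ring
        · change i + j - x = i - (x - j)
          ring
        · change x - (j - i) = i - (j - x)
          ring }

theorem dihedralPerm_four_injective : Function.Injective (dihedralPerm 4) := by
  rw [injective_iff_map_eq_one]
  intro g hg
  have h : ∀ x, dihedralPerm 4 g x = x := fun x => by rw [hg]; rfl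
  rcases g with i | i
  · have h0 : (0 : ZMod 4) - i = 0 := h 0
    rw [zero_sub, neg_eq_zero] at h0
    rw [h0]
    rfl
  · have h0 : i - (0 : ZMod 4) = 0 := h 0
    have h1 : i - (1 : ZMod 4) = 1 := h 1
    rw [sub_zero] at h0
    rw [h0] at h1
    exact absurd h1 (by decide)

/-- A 2-group inside `S₄` has order at most 8; at order 8 it is a Sylow subgroup, hence conjugate to
the symmetry group of the square. -/
theorem isBasicGroup_of_injective_perm_four {G : Type*} [Group G] {Y : Type*} [Finite Y]
    (hY : Nat.card Y = 4) {φ : G →* Equiv.Perm Y} (hφ : Function.Injective φ) {k : ℕ}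
    (hG : Nat.card G = 2 ^ k) : IsBasicGroup G := by
  have : Finite G := Finite.of_injective φ hφ
  have : Fact (Nat.Prime 2) := ⟨Nat.prime_two⟩
  have hperm : Nat.card (Equiv.Perm Y) = 24 := by
    rw [Nat.card_perm, hY]; rfl
  have hdvd : 2 ^ k ∣ 24 := by
    rw [← hG, ← hperm]
    exact Subgroup.card_dvd_of_injective φ hφ
  have hk : k ≤ 3 := by
    by_contra! hk
    have := (pow_dvd_pow 2 hk).trans hdvd
    norm_num at this
  interval_cases k
  · have := (Nat.card_eq_one_iff_unique.1 hG).1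
    exact Or.inl inferInstance
  · exact Or.inl (isCyclic_of_prime_card (p := 2) (by simpa using hG))
  · exact isBasicGroup_of_card_eq_four (by simpa using hG)
  · refine Or.inr (Or.inr (Or.inl ?_))
    let e : ZMod 4 ≃ Y := (Finite.equivFinOfCardEq hY).symm
    let ψ : DihedralGroup 4 →* Equiv.Perm Y := e.permCongrHom.toMonoidHom.comp (dihedralPerm 4)
    have hψ : Function.Injective ψ :=
      e.permCongrHom.injective.comp dihedralPerm_four_injective
    have hfac : (Nat.card (Equiv.Perm Y)).factorization 2 = 3 := by
      rw [hperm, show 24 = 2 ^ 3 * 3 by norm_num, Nat.factorization_mul (by norm_num) (by norm_num),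
        Nat.prime_two.factorization_pow, Finsupp.add_apply, Finsupp.single_eq_same,
        Nat.factorization_eq_zero_of_not_dvd (show ¬ 2 ∣ 3 by norm_num)]
    have e₁ := MonoidHom.ofInjective hφ
    have e₂ := MonoidHom.ofInjective hψ
    let P : Sylow 2 (Equiv.Perm Y) := Sylow.ofCard φ.range (by
      rw [hfac, ← Nat.card_congr e₁.toEquiv, hG])
    let Q : Sylow 2 (Equiv.Perm Y) := Sylow.ofCard ψ.range (by
      rw [hfac, ← Nat.card_congr e₂.toEquiv, DihedralGroup.nat_card]; norm_num)
    exact ⟨e₁.trans ((Sylow.equiv P Q).trans e₂.symm)⟩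

/-! ### Balanced characters of cyclic and dihedral groups -/

section Balanced

variable {Q : Type*} [Group Q]

/-- The direct sum of linear characters, as a representation. -/
def diagRep {n : ℕ} (l : Fin n → Q →* ℂ) : Representation ℂ Q (Fin n → ℂ) where
  toFun g := Matrix.toLin' (Matrix.diagonal fun i => l i g)
  map_one' := by
    simp
    rfl
  map_mul' g h := by
    rw [Module.End.mul_eq_comp, ← Matrix.toLin'_mul, Matrix.diagonal_mul_diagonal]
    simp

theorem diagRep_character {n : ℕ} (l : Fin n → Q →* ℂ) :
    (diagRep l).character = fun g => ∑ i, l i g := by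
  ext g
  change LinearMap.trace ℂ (Fin n → ℂ) (Matrix.toLin' _) = _
  rw [Matrix.trace_toLin'_eq, Matrix.trace_diagonal]

theorem diagRep_det {n : ℕ} (l : Fin n → Q →* ℂ) (g : Q) :
    LinearMap.det (diagRep l g) = ∏ i, l i g := by
  have h : diagRep l g = Matrix.toLin' (Matrix.diagonal fun i => l i g) := rfl
  rw [h, LinearMap.det_toLin', Matrix.det_diagonal]

variable {ℓ : ℕ} [NeZero ℓ]

theorem conj_stdAddChar (x : ZMod ℓ) : conj (ZMod.stdAddChar x) = ZMod.stdAddChar (-x) := by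
  rw [ZMod.stdAddChar_apply, ZMod.stdAddChar_apply, ← Circle.coe_inv_eq_conj,
    AddChar.map_neg_eq_inv]

theorem stdAddChar_mul_neg (x : ZMod ℓ) :
    (ZMod.stdAddChar x : ℂ) * ZMod.stdAddChar (-x) = 1 := by
  rw [← AddChar.map_add_eq_mul, add_neg_cancel, AddChar.map_zero_eq_one]

/-- The function `ψ + ψ⁻¹ - 2` on `ZMod ℓ`, with `ψ` the character of index `u`. -/
def evenPart (u x : ZMod ℓ) : ℂ := ZMod.stdAddChar (u * x) + ZMod.stdAddChar (-(u * x)) - 2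

/-- A linear character plus its inverse has determinant 1, as does twice the trivial character. -/
theorem isBalanced_evenPart (u : ZMod ℓ) (e : Q →* Multiplicative (ZMod ℓ)) :
    IsBalanced fun x : Q => evenPart u (e x).toAdd := by
  let l : ZMod ℓ → Q →* ℂ := fun u => (AddChar.mulShift ZMod.stdAddChar u).toMonoidHom.comp e
  have hl : ∀ u x, l u x = ZMod.stdAddChar (u * (e x).toAdd) := fun u x => rfl
  refine ⟨fun x => ?_, 2, diagRep ![l u, l (-u)], diagRep ![1, 1], ?_, fun x => ?_⟩
  · simp only [evenPart, map_sub, map_add, conj_stdAddChar, neg_neg, Complex.conj_ofNat]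
    ring
  · rw [diagRep_character, diagRep_character]
    ext x
    simp [hl, evenPart]
    ring
  · rw [diagRep_det, diagRep_det]
    simp [hl, stdAddChar_mul_neg]

/-- The matrices of the two-dimensional representation of the dihedral group induced from the
character of index `u`. -/
def dihedralMatrix (u : ZMod ℓ) : DihedralGroup ℓ → Matrix (Fin 2) (Fin 2) ℂ
  | DihedralGroup.r i => !![ZMod.stdAddChar (u * i), 0; 0, ZMod.stdAddChar (-(u * i))]
  | DihedralGroup.sr i => !![0, ZMod.stdAddChar (-(u * i)); ZMod.stdAddChar (u * i), 0]

theorem dihedralMatrix_mul (u : ZMod ℓ) (g h : DihedralGroup ℓ) :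
    dihedralMatrix u (g * h) = dihedralMatrix u g * dihedralMatrix u h := by
  rcases g with i | i <;> rcases h with j | j <;>
    simp only [DihedralGroup.r_mul_r, DihedralGroup.r_mul_sr, DihedralGroup.sr_mul_r,
      DihedralGroup.sr_mul_sr, dihedralMatrix, Matrix.mul_fin_two, mul_zero, zero_mul, add_zero,
      zero_add, ← AddChar.map_add_eq_mul] <;>
    congr! 4 <;> ring_nf

/-- The two-dimensional representation of the dihedral group induced from the character of
index `u`. -/
def dihedralRep (u : ZMod ℓ) : Representation ℂ (DihedralGroup ℓ) (Fin 2 → ℂ) where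
  toFun g := Matrix.toLin' (dihedralMatrix u g)
  map_one' := by
    have : dihedralMatrix u 1 = 1 := by
      rw [DihedralGroup.one_def, dihedralMatrix, Matrix.one_fin_two]
      simp
    rw [this, Matrix.toLin'_one]
    rfl
  map_mul' g h := by
    rw [dihedralMatrix_mul, Matrix.toLin'_mul]
    rfl

/-- The nontrivial linear character of the dihedral group which is trivial on rotations. -/
def dihedralSign (ℓ : ℕ) : DihedralGroup ℓ →* ℂ where
  toFun g := match g with
    | DihedralGroup.r _ => 1
    | DihedralGroup.sr _ => -1
  map_one' := rfl
  map_mul' g h := by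
    rcases g with i | i <;> rcases h with j | j <;> simp

theorem dihedralSign_r (i : ZMod ℓ) : dihedralSign ℓ (DihedralGroup.r i) = 1 := rfl

theorem dihedralSign_sr (i : ZMod ℓ) : dihedralSign ℓ (DihedralGroup.sr i) = -1 := rfl

/-- The function `σ - 1 - ε` on the dihedral group, where `σ` is the two-dimensional
representation of index `u` and `ε` the sign. -/
def dihedralPart (u : ZMod ℓ) : DihedralGroup ℓ → ℂ
  | DihedralGroup.r i => evenPart u i
  | DihedralGroup.sr _ => 0

/-- Rotations have determinant 1 and reflections determinant `-1` in the two-dimensional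
representation, as in `1 ⊕ ε`. -/
theorem isBalanced_dihedralPart (u : ZMod ℓ) : IsBalanced (dihedralPart u) := by
  refine ⟨fun x => ?_, 2, dihedralRep u, diagRep ![1, dihedralSign ℓ], ?_, fun x => ?_⟩
  · rcases x with i | i
    · simp only [dihedralPart, evenPart, map_sub, map_add, conj_stdAddChar, neg_neg,
        Complex.conj_ofNat]
      ring
    · simp [dihedralPart]
  · rw [diagRep_character]
    ext x
    have : (dihedralRep u).character x = (dihedralMatrix u x).trace := by
      change LinearMap.trace ℂ (Fin 2 → ℂ) (Matrix.toLin' _) = _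
      rw [Matrix.trace_toLin'_eq]
    rw [Pi.sub_apply, this]
    rcases x with i | i
    · simp [dihedralPart, evenPart, dihedralMatrix, dihedralSign_r, Matrix.trace_fin_two]
      ring
    · simp [dihedralPart, dihedralMatrix, dihedralSign_sr, Matrix.trace_fin_two]
  · rw [diagRep_det]
    have : dihedralRep u x = Matrix.toLin' (dihedralMatrix u x) := rfl
    rw [this, LinearMap.det_toLin', Matrix.det_fin_two]
    rcases x with i | i
    · simp [dihedralMatrix, dihedralSign_r, stdAddChar_mul_neg]
    · simp [dihedralMatrix, dihedralSign_sr, mul_comm, stdAddChar_mul_neg]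

/-- For `x ≠ 0` each of the two character sums over the units is `-1`, and the constants give `-2(ℓ
- 1)`. -/
theorem sum_units_evenPart [hℓ : Fact ℓ.Prime] (x : ZMod ℓ) :
    ∑ v : (ZMod ℓ)ˣ, evenPart (v : ZMod ℓ) x = if x = 0 then 0 else -2 * (ℓ : ℂ) := by
  classical
  have hsum : ∀ y : ZMod ℓ, ∑ v : (ZMod ℓ)ˣ, (ZMod.stdAddChar ((v : ZMod ℓ) * y) : ℂ) =
      (if y = 0 then (ℓ : ℂ) else 0) - 1 := by
    intro y
    have h1 := AddChar.sum_mulShift (R := ZMod ℓ) y (ZMod.isPrimitive_stdAddChar ℓ)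
    rw [ZMod.card] at h1
    have h2 : ∑ v : ZMod ℓ, (ZMod.stdAddChar (v * y) : ℂ) =
        1 + ∑ v : (ZMod ℓ)ˣ, (ZMod.stdAddChar ((v : ZMod ℓ) * y) : ℂ) := by
      rw [← Finset.add_sum_erase _ _ (Finset.mem_univ (0 : ZMod ℓ)), zero_mul,
        AddChar.map_zero_eq_one]
      congr 1
      refine Finset.sum_bij' (fun v hv => Units.mk0 v (Finset.ne_of_mem_erase hv))
        (fun v _ => (v : ZMod ℓ)) ?_ ?_ ?_ ?_ ?_ <;> simp
    rw [h1] at h2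
    split_ifs at h2 ⊢ with hy
    · linear_combination -h2
    · push_cast at h2
      linear_combination -h2
  simp only [evenPart, ← mul_neg, Finset.sum_sub_distrib, Finset.sum_add_distrib, hsum,
    Finset.sum_const, Finset.card_univ, ZMod.card_units_eq_totient, Nat.totient_prime hℓ.1,
    nsmul_eq_mul, neg_eq_zero, Nat.cast_sub hℓ.1.one_lt.le]
  split_ifs <;> push_cast <;> ring

end Balanced

/-! ### Groups with a normal subgroup of prime order -/

section PrimeNormal

theorem exists_conjugation_character {G : Type*} [Group G] {L : Subgroup G} [L.Normal] {ℓ : ℕ}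
    [hℓ : Fact ℓ.Prime] (hL : Nat.card L = ℓ) :
    ∃ (e : L ≃* Multiplicative (ZMod ℓ)) (α : G →* (ZMod ℓ)ˣ),
      ∀ (g : G) (x : L), (e (MulAut.conjNormal g x)).toAdd = (α g : ZMod ℓ) * (e x).toAdd := by
  subst hL
  have hc : IsCyclic L := isCyclic_of_prime_card rfl
  let e : L ≃* Multiplicative (ZMod (Nat.card L)) := (zmodCyclicMulEquiv hc).symm
  let f : G → (ZMod (Nat.card L) →+ ZMod (Nat.card L)) := fun g =>
    AddMonoidHom.mk' (fun i => (e (MulAut.conjNormal g (e.symm (Multiplicative.ofAdd i)))).toAdd)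
      (fun i j => by rw [ofAdd_add, map_mul, map_mul, map_mul, toAdd_mul])
  have hf : ∀ g i, f g i = f g 1 * i := by
    intro g i
    have h := ZMod.map_smul (f g) i 1
    rw [smul_eq_mul, mul_one, smul_eq_mul] at h
    rw [h, mul_comm]
  let c : G →* ZMod (Nat.card L) :=
    { toFun := fun g => f g 1
      map_one' := by simp [f]
      map_mul' := fun g h => by
        rw [← hf]
        simp [f] }
  refine ⟨e, MonoidHom.toHomUnits c, fun g x => ?_⟩
  rw [MonoidHom.coe_toHomUnits]
  change _ = f g 1 * _
  rw [← hf]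
  simp [f]

variable {G : Type u} [Group G] [Finite G] {L : Subgroup G} [hLn : L.Normal] {ℓ : ℕ}
  [hℓ : Fact ℓ.Prime] {e : L ≃* Multiplicative (ZMod ℓ)} {α : G →* (ZMod ℓ)ˣ}

open scoped Classical in
-- On `L`, inducing the character of index `u` sums over the coset `u · α(G)`; coset representatives
-- together exhaust the units, so `sum_units_evenPart` applies.
theorem sum_ind_evenPart
    (he : ∀ (g : G) (x : L), (e (MulAut.conjNormal g x)).toAdd = (α g : ZMod ℓ) * (e x).toAdd)
    (hker : α.ker = L) (g : G) [Fintype ((ZMod ℓ)ˣ ⧸ α.range)] :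
    ∑ q : (ZMod ℓ)ˣ ⧸ α.range, ind L (fun x => evenPart (q.out : ZMod ℓ) (e x).toAdd) g =
      extendZero L (fun x => if x = 1 then 0 else -2 * (ℓ : ℂ)) g := by
  classical
  have := Fintype.ofFinite G
  have hcard : Nat.card L = ℓ := by
    rw [Nat.card_congr e.toEquiv]
    exact Nat.card_zmod ℓ
  have hℓ0 : (ℓ : ℂ) ≠ 0 := by exact_mod_cast hℓ.1.ne_zero
  by_cases hg : g ∈ L
  · rw [extendZero_of_mem _ hg]
    have hterm : ∀ u : (ZMod ℓ)ˣ, ind L (fun x => evenPart (u : ZMod ℓ) (e x).toAdd) g =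
        ∑ a : α.range, evenPart ((u * a : (ZMod ℓ)ˣ) : ZMod ℓ) (e ⟨g, hg⟩).toAdd := by
      intro u
      rw [ind_apply, hcard]
      have h1 : ∀ x : G, extendZero L (fun x => evenPart (u : ZMod ℓ) (e x).toAdd) (x⁻¹ * g * x) =
          evenPart ((u * α x⁻¹ : (ZMod ℓ)ˣ) : ZMod ℓ) (e ⟨g, hg⟩).toAdd := by
        intro x
        have hx : x⁻¹ * g * x ∈ L := by simpa using hLn.conj_mem g hg x⁻¹
        rw [extendZero_of_mem _ hx]
        have h2 : (⟨x⁻¹ * g * x, hx⟩ : L) = MulAut.conjNormal x⁻¹ ⟨g, hg⟩ := by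
          ext
          simp
        rw [h2]
        simp only [evenPart, he, Units.val_mul, mul_assoc]
      simp only [h1]
      have h5 : ∑ x : G, evenPart ((u * α x⁻¹ : (ZMod ℓ)ˣ) : ZMod ℓ) (e ⟨g, hg⟩).toAdd =
          ∑ x : G, evenPart ((u * α x : (ZMod ℓ)ˣ) : ZMod ℓ) (e ⟨g, hg⟩).toAdd :=
        Equiv.sum_comp (Equiv.inv G) fun x =>
          evenPart ((u * α x : (ZMod ℓ)ˣ) : ZMod ℓ) (e ⟨g, hg⟩).toAdd
      rw [h5]
      have h3 := sum_comp_eq_card_ker_mul_sum α.rangeRestrict_surjective fun a : α.range =>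
        evenPart ((u * a : (ZMod ℓ)ˣ) : ZMod ℓ) (e ⟨g, hg⟩).toAdd
      rw [MonoidHom.ker_rangeRestrict, hker, hcard] at h3
      simp only [MonoidHom.coe_rangeRestrict] at h3
      rw [h3]
      field_simp
    simp only [hterm]
    rw [← Fintype.sum_prod_type' (f := fun (q : (ZMod ℓ)ˣ ⧸ α.range) (a : α.range) =>
      evenPart ((q.out * a : (ZMod ℓ)ˣ) : ZMod ℓ) (e ⟨g, hg⟩).toAdd)]
    have h4 := (groupEquivQuotientProd α.range).symm.sum_comp fun v : (ZMod ℓ)ˣ =>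
      evenPart (v : ZMod ℓ) (e ⟨g, hg⟩).toAdd
    refine (h4.trans (sum_units_evenPart _)).trans ?_
    congr 1
    rw [toAdd_eq_zero, map_eq_one_iff e e.injective]
  · rw [extendZero_of_notMem _ hg]
    refine Finset.sum_eq_zero fun q _ => ?_
    rw [ind_apply, Finset.sum_eq_zero, mul_zero]
    intro x _
    refine extendZero_of_notMem _ fun h => hg ?_
    have := hLn.conj_mem _ h x
    convert this using 1
    group

open scoped Classical in
theorem two_smul_mem_basicSpan
    (he : ∀ (g : G) (x : L), (e (MulAut.conjNormal g x)).toAdd = (α g : ZMod ℓ) * (e x).toAdd)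
    (hker : α.ker = L) :
    2 • extendZero L (fun x => if x = 1 then 0 else -(ℓ : ℂ)) ∈ basicSpan G := by
  classical
  have := Fintype.ofFinite ((ZMod ℓ)ˣ ⧸ α.range)
  have hcyc : IsCyclic L := isCyclic_of_prime_card (p := ℓ) (by
    rw [Nat.card_congr e.toEquiv]
    exact Nat.card_zmod ℓ)
  have h : ∑ q : (ZMod ℓ)ˣ ⧸ α.range, ind L (fun x => evenPart (q.out : ZMod ℓ) (e x).toAdd) ∈
      basicSpan G := sum_mem fun q _ =>
    ind_mem_basicSpan L ((isBalanced_evenPart _ e.toMonoidHom).mem_basicSpan (Or.inl hcyc))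
  convert h using 1
  ext g
  rw [Finset.sum_apply, sum_ind_evenPart he hker, Pi.smul_apply]
  by_cases hg : g ∈ L
  · rw [extendZero_of_mem _ hg, extendZero_of_mem _ hg]
    split_ifs <;> simp
  · rw [extendZero_of_notMem _ hg, extendZero_of_notMem _ hg, smul_zero]

/-- The subgroup generated by `L` and an involution inverting it, as a dihedral group. -/
def dihedralHom (e : L ≃* Multiplicative (ZMod ℓ)) (t : G) (ht : t * t = 1)
    (hinv : ∀ x : L, t * x * t = (x : G)⁻¹) : DihedralGroup ℓ →* G where
  toFun g := match g with
    | DihedralGroup.r i => (e.symm (Multiplicative.ofAdd i) : G)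
    | DihedralGroup.sr i => t * (e.symm (Multiplicative.ofAdd i) : G)
  map_one' := by
    rw [DihedralGroup.one_def]
    simp
  map_mul' g h := by
    have hinv' : ∀ x : L, (x : G) * t = t * (x : G)⁻¹ := by
      intro x
      rw [← hinv x, ← mul_assoc, ← mul_assoc, ht, one_mul]
    rcases g with i | i <;> rcases h with j | j
    · simp
    · simp only [DihedralGroup.r_mul_sr]
      rw [← mul_assoc, hinv', sub_eq_neg_add, ofAdd_add, ofAdd_neg, map_mul, map_inv,
        Subgroup.coe_mul, Subgroup.coe_inv, mul_assoc]
    · simp [mul_assoc]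
    · simp only [DihedralGroup.sr_mul_sr]
      rw [mul_assoc, ← mul_assoc _ t, hinv', ← mul_assoc, ← mul_assoc, ht, one_mul,
        sub_eq_neg_add, ofAdd_add, ofAdd_neg, map_mul, map_inv, Subgroup.coe_mul, Subgroup.coe_inv]

open scoped Classical in
-- As `t` lies outside the kernel of `α` and squares to 1, it inverts `L`, so `L` and `t` generate a
-- dihedral group. The functions `dihedralPart u` live on the rotations, so inducing from this group
-- gives half of what inducing from `L` gives, which removes the factor 2 of
-- `two_smul_mem_basicSpan`.
theorem mem_basicSpan_of_involution
    (he : ∀ (g : G) (x : L), (e (MulAut.conjNormal g x)).toAdd = (α g : ZMod ℓ) * (e x).toAdd)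
    (hker : α.ker = L) (hodd : Odd ℓ) {t : G} (ht : t * t = 1) (htL : t ∉ L) :
    extendZero L (fun x => if x = 1 then 0 else -(ℓ : ℂ)) ∈ basicSpan G := by
  classical
  have := Fintype.ofFinite ((ZMod ℓ)ˣ ⧸ α.range)
  have := Fintype.ofFinite G
  have hLcard : Nat.card L = ℓ := by
    rw [Nat.card_congr e.toEquiv]
    exact Nat.card_zmod ℓ
  have htinv : t⁻¹ = t := inv_eq_of_mul_eq_one_left ht
  have hα : (α t : ZMod ℓ) = -1 := by
    have h1 : (α t : ZMod ℓ) * α t = 1 := by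
      rw [← Units.val_mul, ← map_mul, ht, map_one, Units.val_one]
    rcases mul_self_eq_one_iff.1 h1 with h2 | h2
    · exact absurd (hker ▸ MonoidHom.mem_ker.2 (Units.ext h2)) htL
    · exact h2
  have hinv : ∀ x : L, t * x * t = (x : G)⁻¹ := by
    intro x
    have h1 : MulAut.conjNormal t x = x⁻¹ := by
      apply e.injective
      apply Multiplicative.toAdd.injective
      rw [he, hα, map_inv, toAdd_inv]
      ring
    have h2 := congrArg (fun z : L => (z : G)) h1
    simpa [htinv] using h2
  let β := dihedralHom e t ht hinv
  have hr : ∀ i, β (DihedralGroup.r i) = (e.symm (Multiplicative.ofAdd i) : G) := fun _ => rfl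
  have hsr : ∀ i, β (DihedralGroup.sr i) = t * (e.symm (Multiplicative.ofAdd i) : G) := fun _ => rfl
  have hsrL : ∀ i, β (DihedralGroup.sr i) ∉ L := fun i h =>
    htL ((L.mul_mem_cancel_right (e.symm (Multiplicative.ofAdd i)).2).1 h)
  have hβ : Function.Injective β := by
    rw [injective_iff_map_eq_one]
    intro g hg
    rcases g with i | i
    · rw [hr, OneMemClass.coe_eq_one, map_eq_one_iff _ e.symm.injective, ofAdd_eq_one] at hg
      rw [hg]
      rfl
    · exact absurd (hg ▸ L.one_mem) (hsrL i)
  let E : DihedralGroup ℓ ≃* β.range := MonoidHom.ofInjective hβ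
  have hD : IsBasicGroup β.range := Or.inr (Or.inr (Or.inr ⟨ℓ, hℓ.1, hodd, ⟨E.symm⟩⟩))
  have hcard : Nat.card β.range = 2 * ℓ := by
    rw [← Nat.card_congr E.toEquiv, DihedralGroup.nat_card]
  have hmem : ∀ u : ZMod ℓ, ind β.range (dihedralPart u ∘ E.symm) ∈ basicSpan G := fun u =>
    ind_mem_basicSpan _ (((isBalanced_dihedralPart u).comp E.symm.toMonoidHom).mem_basicSpan hD)
  have hval : ∀ u : ZMod ℓ, ∀ z : G, extendZero β.range (dihedralPart u ∘ E.symm) z =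
      extendZero L (fun x => evenPart u (e x).toAdd) z := by
    intro u z
    by_cases hz : z ∈ β.range
    · obtain ⟨g, rfl⟩ := hz
      have hg : β g ∈ β.range := ⟨g, rfl⟩
      have h1 : (⟨β g, hg⟩ : β.range) = E g := rfl
      rw [extendZero_of_mem _ hg]
      rw [h1, Function.comp_apply, MulEquiv.symm_apply_apply]
      rcases g with i | i
      · have hi : β (DihedralGroup.r i) ∈ L := (e.symm (Multiplicative.ofAdd i)).2
        rw [extendZero_of_mem _ hi]
        have h2 : (⟨β (DihedralGroup.r i), hi⟩ : L) = e.symm (Multiplicative.ofAdd i) := rfl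
        rw [h2, MulEquiv.apply_symm_apply]
        rfl
      · rw [extendZero_of_notMem _ (hsrL i)]
        rfl
    · rw [extendZero_of_notMem _ hz, extendZero_of_notMem]
      intro hzL
      refine hz ⟨DihedralGroup.r (e ⟨z, hzL⟩).toAdd, ?_⟩
      rw [hr, ofAdd_toAdd, MulEquiv.symm_apply_apply]
  have hind : ∀ u : ZMod ℓ, ∀ g : G, ind β.range (dihedralPart u ∘ E.symm) g =
      2⁻¹ * ind L (fun x => evenPart u (e x).toAdd) g := by
    intro u g
    rw [ind_apply, ind_apply, hcard, hLcard]
    simp only [hval]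
    push_cast
    rw [mul_inv, mul_assoc]
  have h : ∑ q : (ZMod ℓ)ˣ ⧸ α.range, ind β.range (dihedralPart (q.out : ZMod ℓ) ∘ E.symm) ∈
      basicSpan G := sum_mem fun q _ => hmem _
  convert h using 1
  ext g
  rw [Finset.sum_apply]
  simp only [hind]
  rw [← Finset.mul_sum, sum_ind_evenPart he hker]
  by_cases hg : g ∈ L
  · rw [extendZero_of_mem _ hg, extendZero_of_mem _ hg]
    split_ifs
    · simp
    · ring
  · rw [extendZero_of_notMem _ hg, extendZero_of_notMem _ hg, mul_zero]

theorem permChar_cosetPerm_of_normal (g : G) :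
    permChar (cosetPerm L) g = extendZero L (fun _ => (L.index : ℂ)) g := by
  by_cases hg : g ∈ L
  · rw [extendZero_of_mem _ hg, permChar]
    congr 1
    refine Nat.card_congr (Equiv.subtypeUnivEquiv fun c => ?_)
    refine (smul_eq_iff_conj_mem g c).2 ?_
    simpa using hLn.conj_mem g hg c.out⁻¹
  · rw [extendZero_of_notMem _ hg]
    by_contra hne
    obtain ⟨x, hx⟩ := exists_mem_of_permChar_cosetPerm_ne_zero hne
    refine hg ?_
    have := hLn.conj_mem _ hx x
    convert this using 1
    group

open scoped Classical in
-- `G` is a Frobenius-type group: `L` acts regularly on `G/H`, and each element outside `L` has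
-- exactly one fixed point.
theorem permChar_cosetPerm_of_complement
    (he : ∀ (g : G) (x : L), (e (MulAut.conjNormal g x)).toAdd = (α g : ZMod ℓ) * (e x).toAdd)
    (hker : α.ker = L) {H : Subgroup G} (hinf : H ⊓ L = ⊥) (hsup : H ⊔ L = ⊤) (g : G) :
    permChar (cosetPerm H) g = 1 + extendZero L (fun x => if x = 1 then ((ℓ : ℂ) - 1) else -1) g := by
  classical
  have hdecomp : ∀ g : G, ∃ h ∈ H, ∃ l : L, g = h * l := by
    intro g
    have hg : g ∈ H ⊔ L := hsup ▸ Subgroup.mem_top g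
    obtain ⟨h, hh, l, hl, rfl⟩ := Subgroup.mem_sup_of_normal_right.1 hg
    exact ⟨h, hh, ⟨l, hl⟩, rfl⟩
  have hHL : ∀ x ∈ H, x ∈ L → x = 1 := fun x hx hxL =>
    Subgroup.mem_bot.1 (hinf ▸ Subgroup.mem_inf.2 ⟨hx, hxL⟩)
  have hbij : Function.Bijective fun l : L => ((l : G) : G ⧸ H) := by
    constructor
    · intro l l' h
      have h1 : (l : G)⁻¹ * l' ∈ H := QuotientGroup.eq.1 h
      have h2 := hHL _ h1 (L.mul_mem (L.inv_mem l.2) l'.2)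
      ext
      exact inv_mul_eq_one.1 h2
    · intro c
      induction c using QuotientGroup.induction_on with
      | H z =>
        obtain ⟨h, hh, l, hz⟩ := hdecomp z⁻¹
        refine ⟨l⁻¹, QuotientGroup.eq.2 ?_⟩
        have : z = (l : G)⁻¹ * h⁻¹ := by rw [← mul_inv_rev, ← hz, inv_inv]
        rw [this]
        simpa using hh
  by_cases hg : g ∈ L
  · rw [extendZero_of_mem _ hg]
    by_cases h1 : g = 1
    · subst h1
      rw [permChar_one, if_pos (show (⟨1, hg⟩ : L) = 1 from rfl), ← Nat.card_congr (Equiv.ofBijective _ hbij),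
        Nat.card_congr e.toEquiv, show Nat.card (Multiplicative (ZMod ℓ)) = ℓ from Nat.card_zmod ℓ]
      ring
    · rw [if_neg (fun h => h1 (congrArg (fun z : L => (z : G)) h)), add_neg_cancel]
      by_contra hne
      obtain ⟨x, hx⟩ := exists_mem_of_permChar_cosetPerm_ne_zero hne
      have h2 := hHL _ hx (by simpa using hLn.conj_mem g hg x⁻¹)
      refine h1 ?_
      have h3 : g = x * (x⁻¹ * g * x) * x⁻¹ := by group
      rw [h3, h2]
      group
  · rw [extendZero_of_notMem _ hg, add_zero, permChar]
    obtain ⟨h, hh, l₁, rfl⟩ := hdecomp g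
    have hα : (α h⁻¹ : ZMod ℓ) - 1 ≠ 0 := by
      intro h0
      have h1 : α h⁻¹ = 1 := Units.ext (sub_eq_zero.1 h0)
      have h2 : h⁻¹ ∈ L := hker ▸ MonoidHom.mem_ker.2 h1
      exact hg (L.mul_mem (inv_inv h ▸ L.inv_mem h2) l₁.2)
    -- With `L` identified with `ℤ/ℓ`, the fixed-point condition is a linear equation with leading
    -- coefficient `α h⁻¹ - 1`, nonzero because `h` is not in `L`.
    have hfix : ∀ l : L, (h * l₁ : G) • ((l : G) : G ⧸ H) = ((l : G) : G ⧸ H) ↔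
        (e l).toAdd = (e l₁).toAdd / ((α h⁻¹ : ZMod ℓ) - 1) := by
      intro l
      let m : L := (MulAut.conjNormal h⁻¹ l)⁻¹ * l₁ * l
      have hm : (l : G)⁻¹ * (h * l₁ * l) = h * m := by
        simp only [m, Subgroup.coe_mul, Subgroup.coe_inv, MulAut.conjNormal_apply]
        group
      rw [MulAction.Quotient.smul_coe, smul_eq_mul, eq_comm, QuotientGroup.eq, hm,
        H.mul_mem_cancel_left hh]
      have h1 : (m : G) ∈ H ↔ m = 1 := by
        constructor
        · intro hmH
          ext
          exact hHL _ hmH m.2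
        · intro hm1
          rw [hm1]
          exact H.one_mem
      rw [h1, ← map_eq_one_iff e e.injective, ← toAdd_eq_zero, eq_div_iff hα]
      have h3 := he h⁻¹ l
      simp only [map_inv] at h3
      simp only [m, map_mul, map_inv, toAdd_mul, toAdd_inv]
      constructor <;> intro h2 <;> linear_combination -h2 - h3
    have : Nat.card {c : G ⧸ H // cosetPerm H (h * l₁) c = c} = 1 := by
      let f : L ≃ G ⧸ H := Equiv.ofBijective _ hbij
      rw [Nat.card_eq_one_iff_exists]
      let l₀ : L := e.symm (Multiplicative.ofAdd ((e l₁).toAdd / ((α h⁻¹ : ZMod ℓ) - 1)))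
      have hl₀ : (e l₀).toAdd = (e l₁).toAdd / ((α h⁻¹ : ZMod ℓ) - 1) :=
        congrArg Multiplicative.toAdd (e.apply_symm_apply _)
      refine ⟨⟨f l₀, (hfix l₀).2 hl₀⟩, fun c => ?_⟩
      obtain ⟨c, hc⟩ := c
      obtain ⟨l, rfl⟩ := f.surjective c
      have h1 := (hfix l).1 hc
      have h2 : l = l₀ := by
        apply e.injective
        apply Multiplicative.toAdd.injective
        rw [h1, hl₀]
      exact Subtype.ext (congrArg f h2)
    rw [this, Nat.cast_one]

end PrimeNormal

theorem units_zmod_two_eq_one (v : (ZMod 2)ˣ) : v = 1 := by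
  revert v
  decide

/-- `G/H` is compared with one trivial point plus `r` copies of `G/L`. The two characters differ by
the function equal to `-ℓ` on `L \ {1}` and zero elsewhere. -/
theorem isGood_cosetPerm_of_isComplement {G : Type u} [Group G] [Finite G] {p : ℕ}
    [hp : Fact p.Prime] {L H : Subgroup G} [hLn : L.Normal] {ℓ : ℕ} (hℓ : ℓ.Prime)
    (hL : Nat.card L = ℓ) (hinf : H ⊓ L = ⊥) (hsup : H ⊔ L = ⊤) (hcore : (cosetPerm H).ker = ⊥)
    {k : ℕ} (hH : Nat.card H = p ^ k) (hGL : IsGood p (cosetPerm L)) : IsGood p (cosetPerm H) := by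
  classical
  have : Fact ℓ.Prime := ⟨hℓ⟩
  obtain ⟨e, α, he⟩ := exists_conjugation_character hL
  have hHL : ∀ x ∈ H, x ∈ L → x = 1 := fun x hx hxL =>
    Subgroup.mem_bot.1 (hinf ▸ Subgroup.mem_inf.2 ⟨hx, hxL⟩)
  by_cases hHbot : H = ⊥
  · have hcyc : IsCyclic G := by
      rw [hHbot, bot_sup_eq] at hsup
      refine isCyclic_of_prime_card (p := ℓ) ?_
      rw [← hL, hsup, Subgroup.card_top]
    exact (isGoodGroup_of_isBasicGroup (Or.inl hcyc)).isGood _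
  have hαL : L ≤ α.ker := by
    intro l hl
    rw [MonoidHom.mem_ker]
    ext
    have h1 := he l (e.symm (Multiplicative.ofAdd 1))
    have h2 : MulAut.conjNormal l (e.symm (Multiplicative.ofAdd 1)) =
        e.symm (Multiplicative.ofAdd 1) := by
      have h3 : MulAut.conjNormal l (e.symm (Multiplicative.ofAdd 1)) =
          ⟨l, hl⟩ * e.symm (Multiplicative.ofAdd 1) * (⟨l, hl⟩ : L)⁻¹ := by
        ext
        simp
      rw [h3]
      apply e.injective
      rw [map_mul, map_mul, map_inv, mul_comm, inv_mul_cancel_left]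
    rw [h2, MulEquiv.apply_symm_apply, toAdd_ofAdd, mul_one] at h1
    rw [← h1, Units.val_one]
  have hcomm : ∀ g, α g = 1 → ∀ l : L, g * l * g⁻¹ = l := by
    intro g hg l
    have h1 : MulAut.conjNormal g l = l := by
      apply e.injective
      apply Multiplicative.toAdd.injective
      rw [he, hg, Units.val_one, one_mul]
    have h2 := congrArg (fun z : L => (z : G)) h1
    simpa using h2
  -- The intersection commutes with `L` and is normalised by `H`, so it is normal in `G`;
  -- faithfulness of `G/H` kills it.
  have hkerH : α.ker ⊓ H = ⊥ := by
    have hn : (α.ker ⊓ H).Normal := by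
      refine ⟨fun x hx g => ⟨(inferInstance : α.ker.Normal).conj_mem x hx.1 g, ?_⟩⟩
      have hg : g ∈ H ⊔ L := hsup ▸ Subgroup.mem_top g
      obtain ⟨h, hh, l, hl, rfl⟩ := Subgroup.mem_sup_of_normal_right.1 hg
      have h1 := hcomm x hx.1 ⟨l, hl⟩
      have h2 : l * x * l⁻¹ = x := by
        have h3 : x * l = l * x := by
          rw [← mul_inv_eq_iff_eq_mul]
          exact h1
        rw [← h3, mul_inv_cancel_right]
      have h4 : h * l * x * (h * l)⁻¹ = h * (l * x * l⁻¹) * h⁻¹ := by group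
      change h * l * x * (h * l)⁻¹ ∈ H
      rw [h4, h2]
      exact H.mul_mem (H.mul_mem hh hx.2) (H.inv_mem hh)
    exact le_bot_iff.1 ((le_ker_cosetPerm inf_le_right).trans hcore.le)
  have hker : α.ker = L := by
    refine le_antisymm (fun g hg => ?_) hαL
    have hg' : g ∈ H ⊔ L := hsup ▸ Subgroup.mem_top g
    obtain ⟨h, hh, l, hl, rfl⟩ := Subgroup.mem_sup_of_normal_right.1 hg'
    have h1 : h ∈ α.ker := (α.ker.mul_mem_cancel_right (hαL hl)).1 hg
    have h2 : h = 1 := Subgroup.mem_bot.1 (hkerH ▸ Subgroup.mem_inf.2 ⟨h1, hh⟩)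
    rw [h2, one_mul]
    exact hl
  have hodd : Odd ℓ := by
    refine hℓ.odd_of_ne_two fun h2 => hHbot ?_
    subst h2
    have htop : α.ker = ⊤ := by
      rw [eq_top_iff]
      intro g _
      rw [MonoidHom.mem_ker]
      exact units_zmod_two_eq_one _
    rw [← hkerH, htop, top_inf_eq]
  have hθ : extendZero L (fun x => if x = 1 then 0 else -(ℓ : ℂ)) ∈ localSpan p G := by
    -- For `p = 2` the factor 2 cannot be spared, but `H` is then a nontrivial 2-group and supplies
    -- an involution.
    by_cases h2 : p = 2
    · subst h2
      have hk : k ≠ 0 := fun hk => hHbot (Subgroup.card_eq_one.1 (by rw [hH, hk, pow_zero]))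
      obtain ⟨t, ht⟩ := exists_prime_orderOf_dvd_card' (G := H) 2 (hH ▸ dvd_pow_self 2 hk)
      have ht1 : (t : G) ≠ 1 := fun h1 => by
        rw [OneMemClass.coe_eq_one] at h1
        rw [h1, orderOf_one] at ht
        norm_num at ht
      refine basicSpan_le_localSpan (mem_basicSpan_of_involution he hker hodd (t := t) ?_
        fun h => ht1 (hHL _ t.2 h))
      have := pow_orderOf_eq_one t
      rw [ht, pow_two] at this
      exact congrArg (fun z : H => (z : G)) this
    · have hn : ¬ p ∣ 2 := fun h' => h2 ((Nat.prime_dvd_prime_iff_eq hp.1 Nat.prime_two).1 h')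
      exact ⟨2, hn, two_smul_mem_basicSpan he hker⟩
  let r := α.range.index
  -- This choice of `r` gives the comparison action degree `ℓ`, the degree of `G/H`.
  have hr : r * L.index = ℓ - 1 := by
    rw [← hker, Subgroup.index_ker, mul_comm, Subgroup.card_mul_index, Nat.card_eq_fintype_card,
      ZMod.card_units_eq_totient, Nat.totient_prime hℓ]
  obtain ⟨m, b, hb, hbchar⟩ := exists_isGood_sum (Finset.univ : Finset (Fin r))
    (fun _ => cosetPerm L) (fun _ => hGL)
  let B := sumAct (1 : G →* Equiv.Perm Unit) b
  have hB : IsGood p B := isGood_trivial.sumAct hb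
  have hBchar : ∀ g, permChar B g = 1 + extendZero L (fun _ => (ℓ : ℂ) - 1) g := by
    intro g
    have h1 : ((ℓ - 1 : ℕ) : ℂ) = (ℓ : ℂ) - 1 := by
      rw [Nat.cast_sub hℓ.one_lt.le, Nat.cast_one]
    rw [permChar_sumAct, hbchar, permChar_trivial, ← h1, ← hr]
    simp only [Pi.add_apply, Finset.sum_const, Finset.card_univ, Fintype.card_fin, Pi.smul_apply,
      permChar_cosetPerm_of_normal]
    by_cases hg : g ∈ L
    · simp [extendZero_of_mem _ hg]
    · simp [extendZero_of_notMem _ hg]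
  have hdiff : permChar (cosetPerm H) - permChar B =
      extendZero L (fun x => if x = 1 then 0 else -(ℓ : ℂ)) := by
    ext g
    rw [Pi.sub_apply, hBchar, permChar_cosetPerm_of_complement he hker hinf hsup]
    by_cases hg : g ∈ L
    · rw [extendZero_of_mem _ hg, extendZero_of_mem _ hg, extendZero_of_mem _ hg]
      split_ifs <;> ring
    · rw [extendZero_of_notMem _ hg, extendZero_of_notMem _ hg, extendZero_of_notMem _ hg]
      ring
  have hvalH : ∀ g ∈ H, permChar (cosetPerm H) g = permChar B g := by
    intro g hg
    rw [← sub_eq_zero, ← Pi.sub_apply, hdiff]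
    by_cases hgL : g ∈ L
    · rw [extendZero_of_mem _ hgL, if_pos]
      ext
      exact hHL g hg hgL
    · exact extendZero_of_notMem _ hgL
  refine hB.congr ?_ ?_ (hdiff ▸ hθ)
  · have := hvalH 1 H.one_mem
    rw [permChar_one, permChar_one] at this
    exact_mod_cast this
  · have htop : (sgn (cosetPerm H)).eqLocus (sgn B) = ⊤ := by
      rw [eq_top_iff, ← hsup, sup_le_iff]
      constructor
      · intro g hg
        exact sgn_eq_of_permChar_eq fun j => hvalH _ (H.pow_mem hg j)
      · intro g hg
        have hgℓ : g ^ ℓ = 1 := by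
          have := pow_card_eq_one' (x := (⟨g, hg⟩ : L))
          rw [hL] at this
          exact congrArg (fun z : L => (z : G)) this
        change sgn (cosetPerm H) g = sgn B g
        rw [sgn_eq_one_of_odd _ hodd hgℓ, sgn_eq_one_of_odd _ hodd hgℓ]
    ext1 g
    exact (htop ▸ Subgroup.mem_top g : g ∈ (sgn (cosetPerm H)).eqLocus (sgn B))

/-! ### Hyperelementary groups -/

/-- `G` is `p`-hyperelementary: an extension of a `p`-group by a cyclic group of order prime
to `p`. -/
def IsHyper (p : ℕ) (G : Type*) [Group G] : Prop :=
  ∃ C : Subgroup G, C.Normal ∧ IsCyclic C ∧ ¬ p ∣ Nat.card C ∧ ∃ k, C.index = p ^ k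

section

variable {G : Type u} [Group G] [Finite G] {p : ℕ} [hp : Fact p.Prime]

theorem IsHyper.subgroup (h : IsHyper p G) (M : Subgroup G) : IsHyper p M := by
  obtain ⟨C, hn, hc, hcard, k, hk⟩ := h
  have hinj : Function.Injective (M.subtype.subgroupComap C) := fun x y hxy => by
    ext
    exact congrArg (fun z : C => (z : G)) hxy
  refine ⟨C.subgroupOf M, inferInstance, isCyclic_of_injective (M.subtype.subgroupComap C) hinj,
    fun hd => hcard (hd.trans (Subgroup.card_dvd_of_injective _ hinj)), ?_⟩
  have hd : (C.subgroupOf M).index ∣ p ^ k := hk ▸ Subgroup.relIndex_dvd_index_of_normal C M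
  obtain ⟨j, -, hj⟩ := (Nat.dvd_prime_pow hp.1).1 hd
  exact ⟨j, hj⟩

theorem IsHyper.quotient (h : IsHyper p G) (N : Subgroup G) [N.Normal] : IsHyper p (G ⧸ N) := by
  obtain ⟨C, hn, hc, hcard, k, hk⟩ := h
  refine ⟨C.map (QuotientGroup.mk' N), hn.map _ (QuotientGroup.mk'_surjective N),
    isCyclic_of_surjective _ ((QuotientGroup.mk' N).subgroupMap_surjective C),
    fun hd => hcard (hd.trans (Subgroup.card_map_dvd C _)), ?_⟩
  have hd : (C.map (QuotientGroup.mk' N)).index ∣ p ^ k :=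
    hk ▸ Subgroup.index_map_dvd C (QuotientGroup.mk'_surjective N)
  obtain ⟨j, -, hj⟩ := (Nat.dvd_prime_pow hp.1).1 hd
  exact ⟨j, hj⟩

theorem normal_of_le_cyclic {C D : Subgroup G} [hn : C.Normal] [IsCyclic C] (hD : D ≤ C) :
    D.Normal := by
  refine ⟨fun x hx g => ?_⟩
  obtain ⟨m, hm⟩ := MonoidHom.map_cyclic (MulAut.conjNormal g : MulAut C).toMonoidHom
  have h := congrArg (fun z : C => (z : G)) (hm ⟨x, hD hx⟩)
  have h' : g * x * g⁻¹ = x ^ m := by simpa using h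
  rw [h']
  exact D.zpow_mem hx m

/-- `L` fixes every coset of `M`, and its cocycle values have odd order, so every sign is trivial on
them. -/
theorem le_ker_indPerm_signAct {M L : Subgroup G} [hL : L.Normal] (hLM : L ≤ M)
    (hodd : Odd (Nat.card L)) (s : M →* ℤˣ) : L ≤ (indPerm (signAct s)).ker := by
  intro l hl
  rw [MonoidHom.mem_ker]
  ext1 y
  have hconj : y.1.out⁻¹ * l * y.1.out ∈ L := by simpa using hL.conj_mem l hl y.1.out⁻¹
  have h1 : l • y.1 = y.1 := (smul_eq_iff_conj_mem l y.1).2 (hLM hconj)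
  have h2 : cosetCocycle M l y.1 ^ Nat.card L = 1 := by
    ext
    have hcoe : (cosetCocycle M l y.1 : G) = y.1.out⁻¹ * l * y.1.out := by
      simp [cosetCocycle, h1]
    rw [Subgroup.coe_pow, hcoe]
    have := pow_card_eq_one' (x := (⟨_, hconj⟩ : L))
    exact congrArg (fun z : L => (z : G)) this
  have h3 : s (cosetCocycle M l y.1) = 1 := by
    have := sgn_eq_one_of_odd (signAct s) hodd h2
    rwa [sgn_signAct] at this
  rw [indPerm_apply, h1]
  simp [signAct, h3]

/-- Induction on the order handles non-faithful actions through quotients and proper subgroups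
through restriction, leaving `G/H` with `H` core-free. -/
theorem IsHyper.isGoodGroup (h : IsHyper p G) : IsGoodGroup p G := by
  induction hn : Nat.card G using Nat.strong_induction_on generalizing G with
  | _ n ih =>
  have hquot : ∀ {X : Type u} [Finite X] (a : G →* Equiv.Perm X), a.ker ≠ ⊥ → IsGood p a := by
    intro X _ a ha
    refine isGood_of_quotient a (ih _ ?_ (h.quotient _) rfl)
    have h1 := Subgroup.card_eq_card_quotient_mul_card_subgroup a.ker
    have h2 : 1 < Nat.card a.ker := (Subgroup.one_lt_card_iff_ne_bot _).2 ha
    have h3 : 0 < Nat.card (G ⧸ a.ker) := Nat.card_pos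
    rw [← hn, h1]
    exact (Nat.lt_mul_iff_one_lt_right h3).2 h2
  have hsub : ∀ M : Subgroup G, M ≠ ⊤ → IsGoodGroup p M := by
    intro M hM
    refine ih _ ?_ (h.subgroup M) rfl
    rw [← hn]
    refine lt_of_le_of_ne (Subgroup.card_le_card_group M) fun hc => hM ?_
    exact Subgroup.eq_top_of_card_eq M hc
  by_cases hcyc : IsCyclic G
  · exact isGoodGroup_of_isBasicGroup (Or.inl hcyc)
  have hnontriv : Nontrivial G := by
    by_contra hc
    rw [not_nontrivial_iff_subsingleton] at hc
    exact hcyc inferInstance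
  refine isGoodGroup_of_forall_cosetPerm fun H => ?_
  by_cases hker : (cosetPerm H).ker = ⊥
  swap
  · exact hquot _ hker
  have hcore : ∀ D : Subgroup G, D.Normal → D ≤ H → D = ⊥ := fun D hD hDH =>
    le_bot_iff.1 ((le_ker_cosetPerm hDH).trans hker.le)
  have hHtop : H ≠ ⊤ := by
    rintro rfl
    exact top_ne_bot (hcore ⊤ inferInstance le_rfl)
  -- The normal subgroup `L` serves only to make the action on `G/M` non-faithful, hence good.
  have hstep : ∀ M L : Subgroup G, H ≤ M → M ≠ ⊤ → L.Normal → L ≠ ⊥ → L ≤ M →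
      (p = 2 → ∀ s : M →* ℤˣ, IsGood p (indPerm (signAct s))) → IsGood p (cosetPerm H) := by
    intro M L hHM hM hLn hL hLM hs
    have hcM : IsGood p (cosetPerm M) := hquot _ fun hb =>
      hL (le_bot_iff.1 ((le_ker_cosetPerm hLM).trans hb.le))
    refine isGood_cosetPerm_of_le hHM ?_
    by_cases h2 : p = 2
    · exact isGood_indPerm_of_signAct (hsub M hM) hcM (hs h2) _
    · exact isGood_indPerm_of_ne_two h2 (hsub M hM) hcM _
  obtain ⟨C, hCn, hCc, hCp, k, hCk⟩ := id h
  by_cases hC : C = ⊥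
  · rw [hC, Subgroup.index_bot] at hCk
    obtain ⟨j, hjk, hj⟩ := (Nat.dvd_prime_pow hp.1).1 (hCk ▸ Subgroup.card_subgroup_dvd_card H)
    have hjk' : j < k := by
      refine lt_of_le_of_ne hjk fun hjk' => hHtop (Subgroup.eq_top_of_card_eq H ?_)
      rw [hj, hCk, hjk']
    obtain ⟨M, hMc, hHM⟩ := Sylow.exists_subgroup_card_pow_prime_le p (m := k - 1) (n := j)
      (by rw [hCk]; exact pow_dvd_pow p (Nat.sub_le _ _)) H hj (by omega)
    have hMi : M.index = p := by
      have h1 := M.card_mul_index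
      rw [hMc, hCk] at h1
      have h2 : p ^ k = p ^ (k - 1) * p := by rw [← pow_succ]; congr 1; omega
      rw [h2] at h1
      exact Nat.eq_of_mul_eq_mul_left (pow_pos hp.1.pos _) h1
    have hMn : M.Normal := Subgroup.normal_of_index_eq_minFac_card (by
      rw [hMi, hCk, hp.1.pow_minFac (by omega)])
    have hMbot : M ≠ ⊥ := by
      rintro rfl
      rw [Subgroup.index_bot] at hMi
      exact hcyc (isCyclic_of_prime_card hMi)
    have hMtop : M ≠ ⊤ := by
      rintro rfl
      rw [Subgroup.index_top] at hMi
      exact hp.1.one_lt.ne hMi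
    refine hstep M M hHM hMtop hMn hMbot le_rfl fun h2 s => ?_
    -- This action has `2 · 2 = 4` points, so if it is faithful then `G` is a 2-group inside `S₄`.
    by_cases hs : (indPerm (signAct s)).ker = ⊥
    · have h4 : Nat.card ((G ⧸ M) × ℤˣ) = 4 := by
        rw [Nat.card_prod, ← Subgroup.index, hMi, h2, Nat.card_eq_fintype_card (α := ℤˣ)]
        rfl
      have hb := isBasicGroup_of_injective_perm_four h4 ((MonoidHom.ker_eq_bot_iff _).1 hs)
        (by rw [hCk, h2])
      exact (isGoodGroup_of_isBasicGroup hb).isGood _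
    · exact hquot _ hs
  · have hCcard : Nat.card C ≠ 1 := fun hc => hC (Subgroup.card_eq_one.1 hc)
    obtain ⟨ℓ, hℓ, hℓd⟩ := Nat.exists_prime_and_dvd hCcard
    have : Fact ℓ.Prime := ⟨hℓ⟩
    obtain ⟨x, hx⟩ := exists_prime_orderOf_dvd_card' (G := C) ℓ hℓd
    let L : Subgroup G := Subgroup.zpowers (x : G)
    have hLC : L ≤ C := by
      rw [Subgroup.zpowers_le]
      exact x.2
    have hLcard : Nat.card L = ℓ := by
      rw [Nat.card_zpowers, Subgroup.orderOf_coe, hx]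
    have hLbot : L ≠ ⊥ := fun hb => by
      rw [hb, Subgroup.card_bot] at hLcard
      exact hℓ.one_lt.ne hLcard
    have hLn : L.Normal := normal_of_le_cyclic hLC
    have hHC : H ⊓ C = ⊥ := hcore _ (normal_of_le_cyclic inf_le_right) inf_le_left
    -- Either `H` is a complement of `L`, or `H ⊔ L` is a proper intermediate subgroup containing
    -- `L`.
    by_cases hM : H ⊔ L = ⊤
    · have hHd : Nat.card H ∣ p ^ k := by
        have h1 := Subgroup.relIndex_dvd_index_of_normal C H
        rw [hCk, ← Subgroup.inf_relIndex_left, hHC, Subgroup.relIndex_bot_left] at h1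
        exact h1
      obtain ⟨j, -, hj⟩ := (Nat.dvd_prime_pow hp.1).1 hHd
      refine isGood_cosetPerm_of_isComplement hℓ hLcard ?_ hM hker hj (hquot _ ?_)
      · exact le_bot_iff.1 ((inf_le_inf_left H hLC).trans hHC.le)
      · exact fun hb => hLbot (le_bot_iff.1 ((le_ker_cosetPerm le_rfl).trans hb.le))
    · refine hstep (H ⊔ L) L le_sup_left hM hLn hLbot le_sup_right fun h2 s => hquot _ fun hb => ?_
      have hodd : Odd (Nat.card L) := by
        rw [hLcard]
        refine hℓ.odd_of_ne_two fun hℓ2 => hCp ?_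
        rw [h2, ← hℓ2]
        exact hℓd
      exact hLbot (le_bot_iff.1 ((le_ker_indPerm_signAct le_sup_right hodd s).trans hb.le))

end

/-! ### Reduction to hyperelementary subgroups -/

section

variable {G : Type u} [Group G] [Finite G] {p : ℕ} [hp : Fact p.Prime]

/-- Take `C` generated by the `p'`-part of `x`, `N` its normaliser, and `K` the preimage in `N` of a
Sylow `p`-subgroup of `N/C`. All fixed points of `x` lie over the coset `N`, and their number is
congruent modulo `p` to the index of `K` in `N`. -/
theorem exists_isHyper_subgroup (p : ℕ) [hp : Fact p.Prime] (x : G) :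
    ∃ (N : Subgroup G) (K : Subgroup N), IsHyper p K ∧
      ¬ p ∣ Nat.card {y // indPerm (cosetPerm K) x y = y} := by
  classical
  obtain ⟨k, m, hm, hord⟩ := Nat.exists_eq_pow_mul_and_not_dvd (orderOf_pos x).ne' p hp.1.ne_one
  let C : Subgroup G := Subgroup.zpowers (x ^ p ^ k)
  have hCcard : Nat.card C = m := by
    rw [Nat.card_zpowers, orderOf_pow_of_dvd (pow_pos hp.1.pos k).ne' (hord ▸ dvd_mul_right _ _),
      hord, Nat.mul_div_cancel_left _ (pow_pos hp.1.pos k)]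
  let N : Subgroup G := Subgroup.normalizer (C : Set G)
  have hCN : C ≤ N := Subgroup.le_normalizer
  have hxN : x ∈ N := by
    rw [Subgroup.mem_normalizer_iff]
    intro z
    have hz : ∀ z ∈ C, x * z = z * x := by
      intro z hz
      obtain ⟨j, rfl⟩ := Subgroup.mem_zpowers_iff.1 hz
      exact (((Commute.refl x).pow_right _).zpow_right j).eq
    constructor
    · intro h
      rwa [hz z h, mul_inv_cancel_right]
    · intro h
      have h1 := hz _ h
      have h2 : x * z * x⁻¹ = z := by
        have h3 : x * (x * z * x⁻¹) = x * z := by rw [h1]; group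
        exact mul_left_cancel h3
      rwa [← h2]
  let C' : Subgroup N := C.subgroupOf N
  have hC'n : C'.Normal := Subgroup.normal_in_normalizer
  let f := QuotientGroup.mk' C'
  have hf : Function.Surjective f := QuotientGroup.mk'_surjective C'
  have hker : f.ker = C' := QuotientGroup.ker_mk' C'
  obtain ⟨S⟩ := (inferInstance : Nonempty (Sylow p (N ⧸ C')))
  let K : Subgroup N := (S : Subgroup (N ⧸ C')).comap f
  have hC'K : C' ≤ K := hker ▸ Subgroup.ker_le_comap f _
  have hKmap : K.map f = S := Subgroup.map_comap_eq_self_of_surjective hf _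
  have hC'card : Nat.card C' = m := by
    rw [← hCcard]
    exact Nat.card_congr (Subgroup.subgroupOfEquivOfLe hCN).toEquiv
  have hmem : ∀ y : N, y ∈ K → y ^ m = 1 → y ∈ C' := by
    intro y hy hym
    rw [← hker, MonoidHom.mem_ker]
    obtain ⟨j, hj⟩ := S.isPGroup' ⟨f y, hy⟩
    have hj' : f y ^ p ^ j = 1 := congrArg (fun z : (S : Subgroup (N ⧸ C')) => (z : N ⧸ C')) hj
    have hm' : f y ^ m = 1 := by rw [← map_pow, hym, map_one]
    have hcop : Nat.gcd (p ^ j) m = 1 :=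
      Nat.Coprime.pow_left j ((Nat.Prime.coprime_iff_not_dvd hp.1).2 hm)
    have h1 := Nat.dvd_gcd (orderOf_dvd_of_pow_eq_one hj') (orderOf_dvd_of_pow_eq_one hm')
    rw [hcop, Nat.dvd_one, orderOf_eq_one_iff] at h1
    exact h1
  have hxm : (x ^ p ^ k) ^ m = 1 := by rw [← pow_mul, ← hord, pow_orderOf_eq_one]
  -- If a conjugate of `x` lies in `K`, its `p'`-part lies in `C` by `hmem`, so the conjugating
  -- element normalises `C`.
  have hconj : ∀ g : G, (∃ h : g⁻¹ * x * g ∈ N, (⟨g⁻¹ * x * g, h⟩ : N) ∈ K) → g ∈ N := by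
    rintro g ⟨h, hK⟩
    have h1 := hmem _ (K.pow_mem hK (p ^ k)) (by
      ext
      have : (g⁻¹ * x * g) = g⁻¹ * x * g⁻¹⁻¹ := by group
      simp only [Subgroup.coe_pow, Subgroup.coe_one]
      rw [this, conj_pow, conj_pow, hxm]
      group)
    have h2 : g⁻¹ * x ^ p ^ k * g ∈ C := by
      have h3 : (g⁻¹ * x * g) ^ p ^ k ∈ C := h1
      have : (g⁻¹ * x * g) = g⁻¹ * x * g⁻¹⁻¹ := by group
      rw [this, conj_pow, inv_inv] at h3
      exact h3
    have hle : ∀ z ∈ C, g⁻¹ * z * g ∈ C := by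
      intro z hz
      obtain ⟨j, rfl⟩ := Subgroup.mem_zpowers_iff.1 hz
      have h3 := C.zpow_mem h2 j
      have h4 : g⁻¹ * x ^ p ^ k * g = g⁻¹ * x ^ p ^ k * g⁻¹⁻¹ := by group
      rw [h4, conj_zpow, inv_inv] at h3
      exact h3
    have : g⁻¹ ∈ N := by
      refine Subgroup.mem_normalizer_fintype fun z hz => ?_
      simpa using hle z hz
    simpa using N.inv_mem this
  refine ⟨N, K, ⟨C'.subgroupOf K, inferInstance, ?_, ?_, ?_⟩, ?_⟩
  · have e := (Subgroup.subgroupOfEquivOfLe hC'K).trans (Subgroup.subgroupOfEquivOfLe hCN)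
    exact isCyclic_of_injective e.toMonoidHom e.injective
  · rwa [Nat.card_congr (Subgroup.subgroupOfEquivOfLe hC'K).toEquiv, hC'card]
  · obtain ⟨j, hj⟩ := IsPGroup.iff_card.1 S.isPGroup'
    refine ⟨j, ?_⟩
    rw [← hj, ← hKmap, ← Subgroup.relIndex_ker, hker]
    rfl
  · let x' : N := ⟨x, hxN⟩
    have hval : permChar (indPerm (cosetPerm K)) x = permChar (cosetPerm K) x' := by
      have := Fintype.ofFinite (G ⧸ N)
      rw [permChar_indPerm, ind_eq_sum_quotient (permChar_conj _),
        Finset.sum_eq_single ((1 : G) : G ⧸ N)]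
      · have hout : (((1 : G) : G ⧸ N).out) ∈ N := by
          have := QuotientGroup.out_eq' ((1 : G) : G ⧸ N)
          rw [eq_comm, QuotientGroup.eq] at this
          simpa using this
        rw [extendZero_of_mem _ (N.mul_mem (N.mul_mem (N.inv_mem hout) hxN) hout)]
        exact permChar_conj (cosetPerm K) ⟨_, hout⟩ x'
      · intro d _ hd
        by_contra hne
        by_cases hdN : d.out⁻¹ * x * d.out ∈ N
        · rw [extendZero_of_mem _ hdN] at hne
          obtain ⟨n, hn⟩ := exists_mem_of_permChar_cosetPerm_ne_zero hne
          have hdn : d.out * n ∈ N := by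
            refine hconj _ ⟨?_, ?_⟩
            · have := (n⁻¹ * ⟨_, hdN⟩ * n).2
              convert this using 1
              simp
              group
            · convert hn using 1
              ext
              simp
              group
          refine hd ?_
          rw [← QuotientGroup.out_eq' d, eq_comm, QuotientGroup.eq]
          simpa using (N.mul_mem_cancel_right n.2).1 hdn
        · exact hne (extendZero_of_notMem _ hdN)
      · simp
    have hval' : Nat.card {y // indPerm (cosetPerm K) x y = y} =
        Nat.card {c // cosetPerm K x' c = c} := by
      rw [permChar, permChar] at hval
      exact_mod_cast hval
    rw [hval']
    let P : Subgroup N := Subgroup.zpowers (x' ^ m)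
    have hPp : IsPGroup p P := by
      rw [IsPGroup.iff_card]
      have hd : Nat.card P ∣ p ^ k := by
        rw [Nat.card_zpowers, orderOf_dvd_iff_pow_eq_one]
        ext
        simp only [Subgroup.coe_pow, Subgroup.coe_one, x']
        rw [← pow_mul, mul_comm, ← hord, pow_orderOf_eq_one]
      obtain ⟨j, -, hj⟩ := (Nat.dvd_prime_pow hp.1).1 hd
      exact ⟨j, hj⟩
    have hmod := hPp.card_modEq_card_fixedPoints (N ⧸ K)
    -- `C` acts trivially on `N/K`, so the fixed points of `x` are those of the `p`-group generated
    -- by `x ^ m`; Bézout recovers `x` from `x ^ m` and `x ^ p ^ k`.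
    have hfix : Nat.card (MulAction.fixedPoints P (N ⧸ K)) =
        Nat.card {c // cosetPerm K x' c = c} := by
      refine Nat.card_congr (Equiv.subtypeEquivRight fun c => ?_)
      rw [MulAction.mem_fixedPoints]
      change _ ↔ x' • c = c
      constructor
      · intro h
        have h1 : x' ^ m ∈ MulAction.stabilizer N c := h ⟨_, Subgroup.mem_zpowers _⟩
        have h2 : x' ^ p ^ k ∈ MulAction.stabilizer N c := by
          have h3 : x' ^ p ^ k ∈ (cosetPerm K).ker :=
            le_ker_cosetPerm hC'K (Subgroup.mem_zpowers (x ^ p ^ k))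
          rw [MonoidHom.mem_ker] at h3
          exact Equiv.congr_fun h3 c
        have hcop : Nat.gcd m (p ^ k) = 1 :=
          (Nat.Coprime.pow_left k ((Nat.Prime.coprime_iff_not_dvd hp.1).2 hm)).symm
        have hb := Nat.gcd_eq_gcd_ab m (p ^ k)
        rw [hcop] at hb
        have h4 : x' = (x' ^ m) ^ (Nat.gcdA m (p ^ k)) * (x' ^ p ^ k) ^ (Nat.gcdB m (p ^ k)) := by
          rw [← zpow_natCast, ← zpow_natCast, ← zpow_mul, ← zpow_mul, ← zpow_add, ← hb]
          simp
        have h5 : x' ∈ MulAction.stabilizer N c := by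
          rw [h4]
          exact mul_mem (zpow_mem h1 _) (zpow_mem h2 _)
        exact h5
      · rintro h ⟨q, hq⟩
        have h1 : P ≤ MulAction.stabilizer N c := by
          rw [Subgroup.zpowers_le]
          exact pow_mem (show x' ∈ MulAction.stabilizer N c from h) m
        exact h1 hq
    rw [hfix] at hmod
    rw [← (hmod.dvd_iff dvd_rfl)]
    have hidx : K.index = (S : Subgroup (N ⧸ C')).index :=
      Subgroup.index_comap_of_surjective _ hf
    change ¬ p ∣ K.index
    rw [hidx]
    exact S.not_dvd_index

/-- Write `m χ = b χ - (b - m) χ` with `m = b x` prime to `p`. The first term is induced from a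
hyperelementary subgroup; the second is again of the same kind and vanishes at `x` as well as
wherever `χ` does. -/
theorem isGoodGroup (p : ℕ) [hp : Fact p.Prime] (G : Type u) [Group G] [Finite G] :
    IsGoodGroup p G := by
  intro χ hχ
  induction hn : (Function.support χ).ncard using Nat.strong_induction_on generalizing χ with
  | _ n ih =>
  by_cases h0 : χ = 0
  · rw [h0]
    exact zero_mem _
  obtain ⟨x, hx⟩ := Function.ne_iff.1 h0
  obtain ⟨N, K, hK, hcard⟩ := exists_isHyper_subgroup p x
  set b := indPerm (cosetPerm K) with hb
  set m := Nat.card {y // b x y = y} with hm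
  have hconj : ∀ y g : G, χ (y⁻¹ * g * y) = χ g := hχ.isBalanced.conj_invariant
  have h1 : permChar b * χ ∈ localSpan p G := by
    have hval : permChar b * χ = ind N (ind K ((χ ∘ N.subtype) ∘ K.subtype)) := by
      rw [hb, permChar_indPerm, permChar_cosetPerm, mul_comm, mul_ind hconj,
        mul_ind (χ := χ ∘ N.subtype) (fun y g => hconj y g), mul_one]
    rw [hval]
    exact ind_mem_localSpan _ (ind_mem_localSpan _ (hK.isGoodGroup _ ((hχ.comp _).comp _)))
  have h2 : IsPermZero (permChar b * χ - permChar (1 : G →* Equiv.Perm (Fin m)) * χ) :=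
    (hχ.mul_permChar b).sub (hχ.mul_permChar _)
  have hval : ∀ g, (permChar b * χ - permChar (1 : G →* Equiv.Perm (Fin m)) * χ) g =
      (permChar b g - m) * χ g := by
    intro g
    rw [permChar_trivial]
    simp [sub_mul]
  have h3 := ih _ (by
    rw [← hn]
    refine Set.ncard_lt_ncard ⟨fun g hg => ?_, fun hsub => ?_⟩ (Set.toFinite _)
    · rw [Function.mem_support, hval] at hg
      exact right_ne_zero_of_mul hg
    · have := hsub hx
      rw [Function.mem_support, hval] at this
      exact this (by rw [permChar, ← hm, sub_self, zero_mul])) _ h2 rfl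
  refine mem_localSpan_of_nsmul hcard ?_
  have h4 := sub_mem h1 h3
  convert h4 using 1
  rw [permChar_trivial]
  ext g
  simp

theorem IsPermZero.mem_basicSpan_of_finite {G : Type u} [Group G] [Finite G] {χ : G → ℂ}
    (h : IsPermZero χ) : χ ∈ basicSpan G :=
  mem_basicSpan_of_forall_localSpan fun p _ => isGoodGroup p G χ h

end

/-! ### Permutation characters -/

theorem ofMulAction_character {G : Type*} [Group G] {X : Type*} [Finite X] [MulAction G X] :
    (Representation.ofMulAction ℂ G X).character = permChar (MulAction.toPermHom G X) := by
  classical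
  have := Fintype.ofFinite X
  ext g
  rw [Representation.character, LinearMap.trace_eq_matrix_trace ℂ (MonoidAlgebra.basis X ℂ),
    Matrix.trace, permChar]
  have : ∀ x : X, LinearMap.toMatrix (MonoidAlgebra.basis X ℂ) (MonoidAlgebra.basis X ℂ)
      (Representation.ofMulAction ℂ G X g) x x = if g • x = x then 1 else 0 := by
    intro x
    rw [LinearMap.toMatrix_apply, MonoidAlgebra.basis_apply, Representation.ofMulAction_single,
      ← MonoidAlgebra.basis_apply, Module.Basis.repr_self, Finsupp.single_apply]
  simp only [Matrix.diag_apply, this]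
  rw [Finset.sum_boole, ← Fintype.card_subtype, ← Nat.card_eq_fintype_card]
  rfl

theorem IsPermutationCharacter.exists_eq_sub {G : Type*} [Group G] {χ : G → ℂ}
    (h : IsPermutationCharacter χ) : ∃ (m n : ℕ) (a : G →* Equiv.Perm (Fin m))
      (b : G →* Equiv.Perm (Fin n)), χ = permChar a - permChar b := by
  induction h using AddSubgroup.closure_induction with
  | mem χ h =>
    obtain ⟨n, _, rfl⟩ := h
    refine ⟨n, 0, MulAction.toPermHom G (Fin n), 1, ?_⟩
    rw [ofMulAction_character, permChar_trivial]
    ext; simp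
  | zero => exact ⟨0, 0, 1, 1, by rw [sub_self]⟩
  | add x y _ _ hx hy =>
    obtain ⟨m, n, a, b, rfl⟩ := hx
    obtain ⟨m', n', a', b', rfl⟩ := hy
    refine ⟨m + m', n + n', finSumFinEquiv.permCongrHom.toMonoidHom.comp (sumAct a a'),
      finSumFinEquiv.permCongrHom.toMonoidHom.comp (sumAct b b'), ?_⟩
    rw [permChar_permCongr, permChar_permCongr, permChar_sumAct, permChar_sumAct]
    abel
  | neg x _ hx =>
    obtain ⟨m, n, a, b, rfl⟩ := hx
    exact ⟨n, m, b, a, by abel⟩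

theorem IsPermutationCharacter.isPermZero {G : Type*} [Group G] [Finite G] {χ : G → ℂ}
    (h : IsPermutationCharacter χ) (hdeg : degree χ = 0) (hdet : HasTrivialDeterminant χ) :
    IsPermZero χ := by
  obtain ⟨m, n, a, b, rfl⟩ := h.exists_eq_sub
  refine isPermZero_sub ?_ (MonoidHom.ext fun g => sgn_eq_of_hasTrivialDeterminant hdet g)
  rw [degree, Pi.sub_apply, permChar_one, permChar_one, sub_eq_zero] at hdeg
  exact_mod_cast hdeg

end CharInduction

end

theorem corollary2p9 {G : Type*} [Group G] [Fintype G] (P : Set (G → ℂ))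
    (hP : ∀ χ ∈ P, CharInduction.IsGeneralisedCharacter χ ∧ CharInduction.IsRealValued χ)
    (hInd : ∀ (H : Subgroup G) (τ : H → ℂ),
      CharInduction.IsGeneralisedCharacter τ → CharInduction.IsRealValued τ →
      CharInduction.degree τ = 0 → CharInduction.HasTrivialDeterminant τ →
      CharInduction.FactorsThroughBasicQuotient τ →
      CharInduction.induced H τ ∈ P)
    (hLin : ∀ (k : ℕ) (τ : Fin k → G → ℂ) (n : Fin k → ℤ),
      (∀ i, τ i ∈ P) → ∑ i, n i • τ i ∈ P) :
    ∀ χ : G → ℂ, CharInduction.IsPermutationCharacter χ → CharInduction.degree χ = 0 →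
      CharInduction.HasTrivialDeterminant χ → χ ∈ P := fun _ hχ hdeg hdet =>
  CharInduction.basicSpan_subset P hInd hLin
    (hχ.isPermZero hdeg hdet).mem_basicSpan_of_finite
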